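/- A convex body in $\mathbb{R}^n$ (a nonempty compact convex set) has constant width if for every unit vector $u$ its two supporting hyperplanes orthogonal to $u$, with outward normals $u$ and $-u$, have distance one. A constant width body $K\subset\mathbb{R}^n$ is called extreme if $K\neq(1-\lambda)K_0+\lambda K_1$ (Minkowski combination) for all $\lambda\in(0,1)$ and all constant width bodies $K_0,K_1\subset\mathbb{R}^n$ which are not translates of each other. A body $K\subset\mathbb{R}^3$ is axially symmetric if it is invariant under all rotations about some line. A constant width body $C\subset\mathbb{R}^2$ is said to generate $K\subset\mathbb{R}^3$ if $C$ is symmetric about some line $\ell\subset\mathbb{R}^2$ and, for some isometric embedding of $\mathbb{R}^2$ as a plane in $\mathbb{R}^3$, $K$ is the set obtained by rotating the image of $C$ about the image of $\ell$. Theorem. Let $K\subset\mathbb{R}^3$ be an axially symmetric body of constant width. Then there is a constant width body $C\subset\mathbb{R}^2$ that generates $K$, and for every constant width body $C\subset\mathbb{R}^2$ that generates $K$, the body $K$ is extreme in $\mathbb{R}^3$ if and only if $C$ is extreme in $\mathbb{R}^2$. -/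

import Mathlib

open scoped Pointwise

noncomputable section

/-- The support function `H_K(u) = max_{x ∈ K} ⟪x, u⟫` of a convex body (Mathlib's convex bodies
are compact and nonempty, so the supremum is a maximum). -/
def supportFunction {E : Type*} [NormedAddCommGroup E] [InnerProductSpace ℝ E]
    (K : ConvexBody E) (u : E) : ℝ :=
  sSup ((fun x : E => inner ℝ x u) '' (K : Set E))

/-- A convex body has constant width (always normalized to be one) if, for every unit vector `u`,
the two supporting hyperplanes of `K` that are orthogonal to `u` have distance one. -/
def HasConstantWidth {E : Type*} [NormedAddCommGroup E] [InnerProductSpace ℝ E]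
    (K : ConvexBody E) : Prop :=
  ∀ u : E, ‖u‖ = 1 → supportFunction K u + supportFunction K (-u) = 1

/-- `K₁` is a translate of `K₀`. -/
def IsTranslateOf {E : Type*} [NormedAddCommGroup E] [InnerProductSpace ℝ E]
    (K₁ K₀ : ConvexBody E) : Prop :=
  ∃ b : E, (K₁ : Set E) = b +ᵥ (K₀ : Set E)

/-- `K` is an extreme constant width body: it has constant width, and it is not a Minkowski
combination `(1 - t) K₀ + t K₁` with `0 < t < 1` of two constant width bodies which are not
translates of each other. -/
def IsExtremeConstantWidth {E : Type*} [NormedAddCommGroup E] [InnerProductSpace ℝ E]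
    (K : ConvexBody E) : Prop :=
  HasConstantWidth K ∧
    ∀ (K₀ K₁ : ConvexBody E) (t : ℝ), HasConstantWidth K₀ → HasConstantWidth K₁ →
      0 < t → t < 1 → ¬ IsTranslateOf K₁ K₀ →
        (K : Set E) ≠ (1 - t) • (K₀ : Set E) + t • (K₁ : Set E)

/-- `g` is a rotation of three-dimensional space about `L` (used for lines `L`): an orientation
preserving isometry that fixes `L` pointwise. -/
def IsRotationAbout (L : AffineSubspace ℝ (EuclideanSpace ℝ (Fin 3)))
    (g : EuclideanSpace ℝ (Fin 3) ≃ᵃⁱ[ℝ] EuclideanSpace ℝ (Fin 3)) : Prop :=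
  (∀ x ∈ L, g x = x) ∧
    LinearMap.det (g.linearIsometryEquiv.toLinearEquiv :
      EuclideanSpace ℝ (Fin 3) →ₗ[ℝ] EuclideanSpace ℝ (Fin 3)) = 1

/-- `K` is axially symmetric: it is invariant under all rotations about some line. -/
def IsAxiallySymmetric (K : ConvexBody (EuclideanSpace ℝ (Fin 3))) : Prop :=
  ∃ L : AffineSubspace ℝ (EuclideanSpace ℝ (Fin 3)),
    Module.finrank ℝ L.direction = 1 ∧
      ∀ g : EuclideanSpace ℝ (Fin 3) ≃ᵃⁱ[ℝ] EuclideanSpace ℝ (Fin 3),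
        IsRotationAbout L g → g '' (K : Set (EuclideanSpace ℝ (Fin 3))) = K

/-- The planar constant width shape `C` generates `K`: `C` has a line of symmetry `l`, and, once
the plane is placed isometrically in space, `K` is obtained by rotating `C` about `l`. -/
def Generates (C : ConvexBody (EuclideanSpace ℝ (Fin 2)))
    (K : ConvexBody (EuclideanSpace ℝ (Fin 3))) : Prop :=
  HasConstantWidth C ∧
    ∃ (l : AffineSubspace ℝ (EuclideanSpace ℝ (Fin 2))) (_ : Nonempty l)
      (j : EuclideanSpace ℝ (Fin 2) →ᵃⁱ[ℝ] EuclideanSpace ℝ (Fin 3)),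
      Module.finrank ℝ l.direction = 1 ∧
      EuclideanGeometry.reflection l '' (C : Set (EuclideanSpace ℝ (Fin 2))) = C ∧
      (K : Set (EuclideanSpace ℝ (Fin 3))) =
        {y | ∃ g : EuclideanSpace ℝ (Fin 3) ≃ᵃⁱ[ℝ] EuclideanSpace ℝ (Fin 3),
          IsRotationAbout (l.map j.toAffineMap) g ∧ ∃ x ∈ C, g (j x) = y}

end

/-! Bodies correspond to sublinear support functions, and width one reads `h u + h (-u) = ‖u‖`. A
body is therefore extreme exactly when every odd `d` with both `h + d` and `h - d` sublinear is
linear (`isExtremeConstantWidth_iff`). After translations the axes pass through the origin, and the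
support functions `k` of the solid and `h` of its profile satisfy `k v = h (ρ • f + ζ • e)`, where
`ζ` is the axial coordinate of `v` and `ρ` its distance from the axis (`IsRotationOf`).

From profile to solid: a perturbation `D` of `k` restricts to a perturbation of `h` on every plane
through the axis, so it is linear on each such plane. Support functions of width one are
differentiable away from the origin, hence `D` is differentiable at the axis vector `w`; its
derivative there agrees with `D` on all these planes, so `D` is linear (`linear_of_planar`).

From solid to profile: a perturbation `d` of `h` splits into a part symmetric in the axis and an
antisymmetric part. The symmetric part revolves to a perturbation of `k` (`linear_of_even`).
Revolving the antisymmetric part would give an even function instead of an odd one, so another route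
is needed. On the tangent line `s ↦ f + s • e` the antisymmetric part is an even perturbation `δ` of
a convex function `η`. Any odd, compactly supported perturbation `γ` of `η` lifts to the odd
perturbation `ρ * γ (ζ / ρ)` of `k`, which must be linear, so `γ = 0`. A nonconstant `δ` would yield
a nonzero `γ`, built from truncations of the derivative of `δ` (`even_perturbation_eq_const`). Hence
`δ` is constant and the antisymmetric part is linear (`linear_of_antisymmetric`). -/

/-! ### Sublinear functions. -/

/-- Positively homogeneous and subadditive real functions. -/
structure IsSublinear {E : Type*} [AddCommGroup E] [Module ℝ E] (h : E → ℝ) : Prop where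
  smul : ∀ c : ℝ, 0 < c → ∀ x, h (c • x) = c * h x
  add_le : ∀ x y, h (x + y) ≤ h x + h y

namespace IsSublinear

variable {E : Type*} [AddCommGroup E] [Module ℝ E] {h h' : E → ℝ}

lemma map_zero (hh : IsSublinear h) : h 0 = 0 := by
  have := hh.smul 2 (by norm_num) 0
  rw [smul_zero] at this
  linarith

lemma smul_nonneg (hh : IsSublinear h) {c : ℝ} (hc : 0 ≤ c) (x : E) : h (c • x) = c * h x := by
  rcases hc.eq_or_lt with rfl | hc
  · simp [hh.map_zero]
  · exact hh.smul c hc x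

lemma convexOn (hh : IsSublinear h) : ConvexOn ℝ Set.univ h := by
  refine ⟨convex_univ, fun x _ y _ a b ha hb _ => ?_⟩
  have := hh.add_le (a • x) (b • y)
  rwa [hh.smul_nonneg ha, hh.smul_nonneg hb] at this

lemma comp_linear (hh : IsSublinear h) {F : Type*} [AddCommGroup F] [Module ℝ F] (T : F →ₗ[ℝ] E) :
    IsSublinear (fun x => h (T x)) :=
  ⟨fun c hc x => by simp [hh.smul c hc], fun x y => by simpa using hh.add_le (T x) (T y)⟩

lemma linear_combination (hh : IsSublinear h) (hh' : IsSublinear h') {a b : ℝ} (ha : 0 ≤ a)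
    (hb : 0 ≤ b) : IsSublinear (fun x => a * h x + b * h' x) :=
  ⟨fun c hc x => by simp only [hh.smul c hc, hh'.smul c hc]; ring, fun x y => by
    nlinarith [mul_le_mul_of_nonneg_left (hh.add_le x y) ha,
      mul_le_mul_of_nonneg_left (hh'.add_le x y) hb]⟩

lemma add_linear (hh : IsSublinear h) (T : E →ₗ[ℝ] ℝ) : IsSublinear (fun x => h x + T x) :=
  ⟨fun c hc x => by simp only [hh.smul c hc, _root_.map_smul, smul_eq_mul]; ring, fun x y => by
    simp only [_root_.map_add]; linarith [hh.add_le x y]⟩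

end IsSublinear

/-! ### Support functions, constant width and extremality. -/

section Support

variable {E : Type*} [NormedAddCommGroup E] [InnerProductSpace ℝ E]

lemma bddAbove_inner_image (K : ConvexBody E) (u : E) :
    BddAbove ((fun x : E => inner ℝ x u) '' (K : Set E)) :=
  (K.isCompact.image (by fun_prop)).bddAbove

lemma inner_le_supportFunction (K : ConvexBody E) {x : E} (hx : x ∈ K) (u : E) :
    inner ℝ x u ≤ supportFunction K u :=
  le_csSup (bddAbove_inner_image K u) ⟨x, hx, rfl⟩

lemma exists_inner_eq_supportFunction (K : ConvexBody E) (u : E) :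
    ∃ x ∈ K, inner ℝ x u = supportFunction K u := by
  obtain ⟨x, hx, hx'⟩ := (K.isCompact.image (f := fun x : E => (inner ℝ x u : ℝ))
    (by fun_prop)).sSup_mem (K.nonempty.image _)
  exact ⟨x, hx, hx'⟩

lemma supportFunction_eq_of (K : ConvexBody E) (u : E) {c : ℝ} (hle : ∀ x ∈ K, inner ℝ x u ≤ c)
    (hc : ∃ x ∈ K, inner ℝ x u = c) : supportFunction K u = c := by
  obtain ⟨x, hx, rfl⟩ := hc
  obtain ⟨y, hy, hy'⟩ := exists_inner_eq_supportFunction K u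
  exact le_antisymm (hy' ▸ hle y hy) (inner_le_supportFunction K hx u)

lemma isSublinear_supportFunction (K : ConvexBody E) : IsSublinear (supportFunction K) := by
  constructor
  · intro c hc u
    obtain ⟨x, hx, hx'⟩ := exists_inner_eq_supportFunction K u
    refine supportFunction_eq_of K _ (fun y hy => ?_) ⟨x, hx, ?_⟩
    · rw [inner_smul_right]
      exact mul_le_mul_of_nonneg_left (inner_le_supportFunction K hy u) hc.le
    · rw [inner_smul_right, hx']
  · intro u v
    obtain ⟨x, hx, hx'⟩ := exists_inner_eq_supportFunction K (u + v)
    rw [← hx', inner_add_right]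
    exact add_le_add (inner_le_supportFunction K hx u) (inner_le_supportFunction K hx v)

lemma mem_of_forall_inner_le [CompleteSpace E] (K : ConvexBody E) {x : E}
    (h : ∀ u, inner ℝ x u ≤ supportFunction K u) : x ∈ K := by
  by_contra hx
  obtain ⟨f, c, hf, hc⟩ := geometric_hahn_banach_closed_point K.convex K.isClosed hx
  set u := (InnerProductSpace.toDual ℝ E).symm f with hu
  have hfu : ∀ y, f y = inner ℝ y u := fun y => by
    rw [real_inner_comm, hu, InnerProductSpace.toDual_symm_apply]
  obtain ⟨y, hy, hy'⟩ := exists_inner_eq_supportFunction K u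
  have h1 := hf y hy
  have h2 := h u
  rw [hfu] at h1 hc
  linarith

lemma supportFunction_injective [CompleteSpace E] {K L : ConvexBody E}
    (h : ∀ u, supportFunction K u = supportFunction L u) : K = L := by
  ext x
  exact ⟨fun hx => mem_of_forall_inner_le L fun u => h u ▸ inner_le_supportFunction K hx u,
    fun hx => mem_of_forall_inner_le K fun u => h u ▸ inner_le_supportFunction L hx u⟩

lemma coe_eq_combination_iff [CompleteSpace E] (K K₀ K₁ : ConvexBody E) {t : ℝ} (ht0 : 0 ≤ t)
    (ht1 : t ≤ 1) :
    (K : Set E) = (1 - t) • (K₀ : Set E) + t • (K₁ : Set E) ↔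
      ∀ u, supportFunction K u = (1 - t) * supportFunction K₀ u + t * supportFunction K₁ u := by
  have key : ∀ u, supportFunction ((1 - t) • K₀ + t • K₁) u =
      (1 - t) * supportFunction K₀ u + t * supportFunction K₁ u := by
    intro u
    refine supportFunction_eq_of _ _ ?_ ?_
    · rintro x ⟨y, ⟨y, hy, rfl⟩, z, ⟨z, hz, rfl⟩, rfl⟩
      simp only [inner_add_left, real_inner_smul_left]
      exact add_le_add
        (mul_le_mul_of_nonneg_left (inner_le_supportFunction K₀ hy u) (by linarith))
        (mul_le_mul_of_nonneg_left (inner_le_supportFunction K₁ hz u) ht0)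
    · obtain ⟨y, hy, hy'⟩ := exists_inner_eq_supportFunction K₀ u
      obtain ⟨z, hz, hz'⟩ := exists_inner_eq_supportFunction K₁ u
      refine ⟨(1 - t) • y + t • z, ⟨_, ⟨y, hy, rfl⟩, _, ⟨z, hz, rfl⟩, rfl⟩, ?_⟩
      simp only [inner_add_left, real_inner_smul_left, hy', hz']
  rw [← ConvexBody.coe_smul, ← ConvexBody.coe_smul, ← ConvexBody.coe_add]
  constructor
  · intro h u
    rw [← key, ConvexBody.ext h]
  · intro h
    rw [supportFunction_injective (K := K) fun u => (h u).trans (key u).symm]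

lemma isTranslateOf_iff [CompleteSpace E] (K₁ K₀ : ConvexBody E) :
    IsTranslateOf K₁ K₀ ↔
      ∃ b : E, ∀ u, supportFunction K₁ u = supportFunction K₀ u + inner ℝ b u := by
  refine exists_congr fun b => ⟨fun h u => ?_, fun h => ?_⟩
  · obtain ⟨y, hy, hy'⟩ := exists_inner_eq_supportFunction K₀ u
    refine supportFunction_eq_of _ _ (fun x hx => ?_) ⟨b + y, ?_, ?_⟩
    · rw [← SetLike.mem_coe, h] at hx
      obtain ⟨z, hz, rfl⟩ := hx
      simp only [vadd_eq_add, inner_add_left]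
      linarith [inner_le_supportFunction K₀ hz u]
    · rw [← SetLike.mem_coe, h]
      exact ⟨y, hy, rfl⟩
    · rw [inner_add_left, hy']; ring
  · ext x
    rw [Set.mem_vadd_set_iff_neg_vadd_mem, vadd_eq_add, SetLike.mem_coe, SetLike.mem_coe]
    constructor
    · refine fun hx => mem_of_forall_inner_le _ fun u => ?_
      rw [inner_add_left, inner_neg_left]
      linarith [h u, inner_le_supportFunction K₁ hx u]
    · refine fun hx => mem_of_forall_inner_le _ fun u => ?_
      have := inner_le_supportFunction K₀ hx u
      rw [inner_add_left, inner_neg_left] at this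
      linarith [h u]

/-- Functions which, like the support functions of bodies of constant width one, satisfy
`h u + h (-u) = ‖u‖`. -/
def HasWidthOne (h : E → ℝ) : Prop := ∀ u, h u + h (-u) = ‖u‖

lemma hasConstantWidth_iff (K : ConvexBody E) :
    HasConstantWidth K ↔ HasWidthOne (supportFunction K) := by
  constructor
  · intro h u
    have hs := isSublinear_supportFunction K
    rcases eq_or_ne u 0 with rfl | hu
    · simp [hs.map_zero]
    · have hn : 0 < ‖u‖ := norm_pos_iff.2 hu
      have h1 := h (‖u‖⁻¹ • u) (by rw [norm_smul, norm_inv, norm_norm, inv_mul_cancel₀ hn.ne'])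
      rw [← smul_neg, hs.smul _ (inv_pos.2 hn), hs.smul _ (inv_pos.2 hn), ← mul_add,
        inv_mul_eq_one₀ hn.ne'] at h1
      exact h1.symm
  · intro h u hu
    rw [h u, hu]

variable [FiniteDimensional ℝ E]

/-- Hahn–Banach: the functional `c • u ↦ c * h u` on the line of `u` is dominated by `h`, for
negative `c` because `0 = h 0 ≤ h (c • u) + h (-c • u)`, and so extends to the whole space. -/
lemma IsSublinear.exists_support {h : E → ℝ} (hh : IsSublinear h) (u : E) :
    ∃ p : E, inner ℝ p u = h u ∧ ∀ v, inner ℝ p v ≤ h v := by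
  have := FiniteDimensional.complete ℝ E
  have key : ∃ T : E →ₗ[ℝ] ℝ, T u = h u ∧ ∀ v, T v ≤ h v := by
    rcases eq_or_ne u 0 with rfl | hu
    · obtain ⟨g, -, hg⟩ := exists_extension_of_le_sublinear (⊥ : E →ₗ.[ℝ] ℝ) h hh.smul hh.add_le
        (by
          rintro ⟨x, hx⟩
          have hx0 : x = 0 := (Submodule.mem_bot ℝ).1 hx
          subst hx0
          have : (⊥ : E →ₗ.[ℝ] ℝ) ⟨0, hx⟩ = 0 := LinearMap.map_zero _
          rw [this]
          simp [hh.map_zero])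
      exact ⟨g, by simp [hh.map_zero], hg⟩
    · obtain ⟨g, hg, hg'⟩ := exists_extension_of_le_sublinear
        (LinearPMap.mkSpanSingleton u (h u) hu) h hh.smul hh.add_le
        (by
          rintro ⟨x, hx⟩
          obtain ⟨c, rfl⟩ := Submodule.mem_span_singleton.1 hx
          rw [LinearPMap.mkSpanSingleton'_apply]
          simp only [RingHom.id_apply, smul_eq_mul]
          rcases le_total 0 c with hc | hc
          · rw [hh.smul_nonneg hc]
          · have h1 := hh.smul_nonneg (neg_nonneg.2 hc) u
            have h2 := hh.add_le (c • u) (-c • u)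
            rw [neg_smul, add_neg_cancel, hh.map_zero, ← neg_smul] at h2
            linarith)
      refine ⟨g, ?_, hg'⟩
      have := hg ⟨u, Submodule.mem_span_singleton_self u⟩
      rw [this]
      exact LinearPMap.mkSpanSingleton_apply ℝ ℝ hu (h u)
  obtain ⟨T, hT, hT'⟩ := key
  refine ⟨(InnerProductSpace.toDual ℝ E).symm T.toContinuousLinearMap, ?_, fun v => ?_⟩
  · rw [InnerProductSpace.toDual_symm_apply]; exact hT
  · rw [InnerProductSpace.toDual_symm_apply]; exact hT' v

lemma IsSublinear.continuous {h : E → ℝ} (hh : IsSublinear h) : Continuous h :=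
  continuousOn_univ.1 (hh.convexOn.continuousOn isOpen_univ)

/-- The body is the intersection of the half-spaces prescribed by `h`; the supporting vectors of
`IsSublinear.exists_support` show that each of these bounds is attained. -/
lemma IsSublinear.exists_convexBody {h : E → ℝ} (hh : IsSublinear h) :
    ∃ K : ConvexBody E, supportFunction K = h := by
  have hclosed : IsClosed {x : E | ∀ u, inner ℝ x u ≤ h u} := by
    simp only [Set.ofPred_forall]
    exact isClosed_iInter fun u => isClosed_le (by fun_prop) continuous_const
  have hbdd : Bornology.IsBounded {x : E | ∀ u, inner ℝ x u ≤ h u} := by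
    obtain ⟨C, hC⟩ := (isCompact_sphere (0 : E) 1).exists_bound_of_continuousOn
      hh.continuous.continuousOn
    refine (Metric.isBounded_closedBall (x := (0 : E)) (r := max C 0)).subset fun x hx => ?_
    rw [mem_closedBall_zero_iff]
    rcases eq_or_ne x 0 with rfl | hx0
    · simp
    · have hn : 0 < ‖x‖ := norm_pos_iff.2 hx0
      have h1 := hx (‖x‖⁻¹ • x)
      rw [real_inner_smul_right, real_inner_self_eq_norm_sq] at h1
      have h2 := hC (‖x‖⁻¹ • x) (by
        rw [mem_sphere_zero_iff_norm, norm_smul, norm_inv, norm_norm, inv_mul_cancel₀ hn.ne'])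
      have h3 : ‖x‖⁻¹ * ‖x‖ ^ 2 = ‖x‖ := by field_simp
      rw [h3] at h1
      exact (h1.trans ((le_abs_self _).trans h2)).trans (le_max_left _ _)
  refine ⟨⟨{x : E | ∀ u, inner ℝ x u ≤ h u}, ?_, Metric.isCompact_of_isClosed_isBounded hclosed hbdd,
    ?_⟩, ?_⟩
  · intro x hx y hy a b ha hb hab u
    rw [inner_add_left, real_inner_smul_left, real_inner_smul_left]
    have : h u = a * h u + b * h u := by rw [← add_mul, hab, one_mul]
    rw [this]
    exact add_le_add (mul_le_mul_of_nonneg_left (hx u) ha) (mul_le_mul_of_nonneg_left (hy u) hb)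
  · obtain ⟨p, -, hp⟩ := hh.exists_support 0
    exact ⟨p, hp⟩
  · funext u
    obtain ⟨p, hp, hp'⟩ := hh.exists_support u
    exact supportFunction_eq_of _ _ (fun x hx => hx u) ⟨p, hp', hp⟩

/-- An extreme body of constant width is one whose support function has no perturbations in both
directions except for linear ones. -/
lemma isExtremeConstantWidth_iff (K : ConvexBody E) :
    IsExtremeConstantWidth K ↔ HasConstantWidth K ∧ ∀ d : E → ℝ, (∀ u, d (-u) = -d u) →
      IsSublinear (fun u => supportFunction K u + d u) →
      IsSublinear (fun u => supportFunction K u - d u) → ∃ b : E, ∀ u, d u = inner ℝ b u := by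
  have := FiniteDimensional.complete ℝ E
  refine and_congr_right fun hK => ?_
  rw [hasConstantWidth_iff] at hK
  constructor
  · intro h d hd h1 h2
    obtain ⟨K₀, hK₀⟩ := h2.exists_convexBody
    obtain ⟨K₁, hK₁⟩ := h1.exists_convexBody
    by_contra hb
    -- The body is the midpoint of the bodies with support functions `h - d` and `h + d`, which are
    -- translates only if `d` is linear.
    refine h K₀ K₁ (1 / 2) ?_ ?_ (by norm_num) (by norm_num) ?_ ?_
    · rw [hasConstantWidth_iff, hK₀]
      intro u
      have := hK u
      simp only [hd]
      linarith
    · rw [hasConstantWidth_iff, hK₁]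
      intro u
      have := hK u
      simp only [hd]
      linarith
    · rw [isTranslateOf_iff, hK₀, hK₁]
      rintro ⟨b, hb'⟩
      refine hb ⟨(1 / 2 : ℝ) • b, fun u => ?_⟩
      rw [real_inner_smul_left]
      linarith [hb' u]
    · rw [coe_eq_combination_iff _ _ _ (by norm_num) (by norm_num), hK₀, hK₁]
      intro u
      norm_num
      ring
  · intro h K₀ K₁ t hK₀ hK₁ ht0 ht1 htr heq
    rw [hasConstantWidth_iff] at hK₀ hK₁
    rw [coe_eq_combination_iff _ _ _ ht0.le ht1.le] at heq
    refine htr ((isTranslateOf_iff _ _).2 ?_)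
    -- This is the largest `c` for which moving the weights `1 - t` and `t` by `c` in either
    -- direction keeps both nonnegative, so that `c * (h₁ - h₀)` is a perturbation in both
    -- directions.
    set c := min t (1 - t) with hc
    have hc0 : 0 < c := lt_min ht0 (by linarith)
    have hs0 := isSublinear_supportFunction K₀
    have hs1 := isSublinear_supportFunction K₁
    have hodd : ∀ u, c * (supportFunction K₁ (-u) - supportFunction K₀ (-u)) =
        -(c * (supportFunction K₁ u - supportFunction K₀ u)) := by
      intro u
      have h2 : supportFunction K₁ (-u) = ‖u‖ - supportFunction K₁ u := by linarith [hK₁ u]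
      have h3 : supportFunction K₀ (-u) = ‖u‖ - supportFunction K₀ u := by linarith [hK₀ u]
      rw [h2, h3]; ring
    have hplus := hs0.linear_combination hs1 (a := 1 - t - c) (b := t + c)
      (by linarith [min_le_right t (1 - t)]) (by linarith)
    have hminus := hs0.linear_combination hs1 (a := 1 - t + c) (b := t - c)
      (by linarith) (by linarith [min_le_left t (1 - t)])
    obtain ⟨b, hb⟩ := h (fun u => c * (supportFunction K₁ u - supportFunction K₀ u)) hodd
      (by convert hplus using 2 with u; rw [heq]; ring)
      (by convert hminus using 2 with u; rw [heq]; ring)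
    refine ⟨c⁻¹ • b, fun u => ?_⟩
    rw [real_inner_smul_left, ← hb]
    field_simp
    ring

/-- A supporting functional `p` at `x` bounds `h` from below; one at `-x`, called `q`, bounds it
from above by `‖v‖ + ⟪q, v⟫`, thanks to the width condition. Both bounds are differentiable at `x`
and touch `h` there, so their difference has zero derivative and `h` is squeezed. -/
lemma IsSublinear.differentiableAt {h : E → ℝ} (hh : IsSublinear h) (hw : HasWidthOne h) {x : E}
    (hx : x ≠ 0) : DifferentiableAt ℝ h x := by
  obtain ⟨p, hp, hp'⟩ := hh.exists_support x
  obtain ⟨q, hq, hq'⟩ := hh.exists_support (-x)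
  have hup : ∀ v, h v ≤ ‖v‖ + inner ℝ q v := fun v => by
    have := hq' (-v)
    rw [inner_neg_right] at this
    linarith [hw v]
  have hlow : ∀ v, inner ℝ p v ≤ h v := hp'
  have hxeq : h x = ‖x‖ + inner ℝ q x := by
    rw [inner_neg_right] at hq
    linarith [hw x]
  have hn : HasFDerivAt (fun v : E => ‖v‖ + inner ℝ q v - inner ℝ p v)
      (fderiv ℝ (fun v : E => ‖v‖) x + innerSL ℝ q - innerSL ℝ p) x :=
    ((((contDiffAt_norm ℝ hx (n := 1)).differentiableAt (by norm_num)).hasFDerivAt).add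
      (innerSL ℝ q).hasFDerivAt).sub (innerSL ℝ p).hasFDerivAt
  have hmin : IsLocalMin (fun v : E => ‖v‖ + inner ℝ q v - inner ℝ p v) x := by
    refine Filter.Eventually.of_forall fun v => ?_
    have h1 := hup v
    have h2 := hlow v
    simp only
    linarith
  have hz := hmin.hasFDerivAt_eq_zero hn
  rw [hz] at hn
  have hd : HasFDerivAt (fun v => h v - inner ℝ p v) (0 : E →L[ℝ] ℝ) x := by
    rw [hasFDerivAt_iff_isLittleO_nhds_zero] at hn ⊢
    refine (Asymptotics.isBigO_of_le _ fun v => ?_).trans_isLittleO hn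
    have h1 := hup (x + v)
    have h2 := hlow (x + v)
    simp only [zero_apply, sub_zero, Real.norm_eq_abs]
    rw [hp, sub_self, sub_zero, abs_of_nonneg (by linarith)]
    refine le_trans ?_ (le_abs_self _)
    linarith
  have := hd.add (innerSL ℝ p).hasFDerivAt
  refine (this.congr_of_eventuallyEq (Filter.Eventually.of_forall fun v => ?_)).differentiableAt
  simp

end Support

/-! ### Even and odd perturbations of a convex function of one variable. -/

/-- The derivative is monotone by convexity and has order connected range by Darboux, which leaves
no room for jumps. -/
lemma ConvexOn.continuous_deriv_of_differentiable {f : ℝ → ℝ} (hf : ConvexOn ℝ Set.univ f)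
    (hd : Differentiable ℝ f) : Continuous (deriv f) := by
  have hmono : Monotone (deriv f) :=
    monotoneOn_univ.1 (hf.monotoneOn_deriv fun x _ => hd x)
  have hord : (Set.range (deriv f)).OrdConnected := by
    rw [← Set.image_univ]
    exact Set.ordConnected_univ.image_deriv fun x _ => hd x
  have h : Continuous (Set.rangeFactorization (deriv f)) :=
    Monotone.continuous_of_surjective (fun x y hxy => hmono hxy) Set.rangeFactorization_surjective
  exact continuous_subtype_val.comp h

section TruncatedDerivative

open intervalIntegral

/-- The even function which, on the nonnegative half line, is `q - q a` cut off at `a`. -/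
def truncation (q : ℝ → ℝ) (a z : ℝ) : ℝ := q (min |z| a) - q a

variable {q e : ℝ → ℝ}

lemma truncation_neg (a z : ℝ) : truncation q a (-z) = truncation q a z := by
  simp [truncation]

lemma truncation_eq_zero {a z : ℝ} (h : a ≤ |z|) : truncation q a z = 0 := by
  simp [truncation, min_eq_right h]

lemma continuous_truncation (hq : Continuous q) (a : ℝ) : Continuous (truncation q a) := by
  unfold truncation
  fun_prop

/-- On each half line the truncation is, up to sign and a constant, `q` frozen beyond `a` or `-a`;
freezing only shrinks increments. Oddness of `q` makes the negative half line look like the positive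
one, and intervals containing `0` are split there. -/
lemma abs_truncation_sub_le (hodd : ∀ z, q (-z) = -q z)
    (hdom : ∀ x y, x ≤ y → |q y - q x| ≤ e y - e x) {a x y : ℝ} (hxy : x ≤ y) :
    |truncation q a y - truncation q a x| ≤ e y - e x := by
  have he : ∀ x y, x ≤ y → e x ≤ e y := fun x y h => by
    linarith [(abs_nonneg _).trans (hdom x y h)]
  have pos : ∀ x y, 0 ≤ x → x ≤ y → |truncation q a y - truncation q a x| ≤ e y - e x := by
    intro x y hx hxy
    have : truncation q a y - truncation q a x = q (min y a) - q (min x a) := by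
      simp only [truncation, abs_of_nonneg hx, abs_of_nonneg (hx.trans hxy)]; ring
    rw [this]
    rcases le_total x a with h | h
    · rw [min_eq_left h]
      have h1 := hdom x (min y a) (le_min hxy h)
      have h2 := he _ _ (min_le_left y a)
      linarith
    · rw [min_eq_right h, min_eq_right (h.trans hxy), sub_self, abs_zero]
      linarith [he _ _ hxy]
  have neg : ∀ x y, y ≤ 0 → x ≤ y → |truncation q a y - truncation q a x| ≤ e y - e x := by
    intro x y hy hxy
    have h1 : ∀ z, min (-z) a = -max z (-a) := fun z => by rw [← min_neg_neg, neg_neg]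
    have : truncation q a y - truncation q a x = -(q (max y (-a)) - q (max x (-a))) := by
      simp only [truncation, abs_of_nonpos hy, abs_of_nonpos (hxy.trans hy), h1, hodd]; ring
    rw [this, abs_neg]
    rcases le_total (-a) y with h | h
    · rw [max_eq_left h]
      have h1 := hdom (max x (-a)) y (max_le hxy h)
      have h2 := he _ _ (le_max_left x (-a))
      linarith
    · rw [max_eq_right h, max_eq_right (hxy.trans h), sub_self, abs_zero]
      linarith [he _ _ hxy]
  rcases le_total 0 x with hx | hx
  · exact pos x y hx hxy
  rcases le_total y 0 with hy | hy
  · exact neg x y hy hxy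
  have h1 := pos 0 y le_rfl hy
  have h2 := neg x 0 le_rfl hx
  have h3 := abs_sub_le (truncation q a y) (truncation q a 0) (truncation q a x)
  linarith

lemma integral_truncation_of_le (hq : Continuous q) {a b : ℝ} (hab : a ≤ b) :
    ∫ z in (0 : ℝ)..b, truncation q a z = ∫ z in (0 : ℝ)..a, truncation q a z := by
  have hc := continuous_truncation hq a
  rw [← integral_add_adjacent_intervals (hc.intervalIntegrable 0 a) (hc.intervalIntegrable a b)]
  have : ∫ z in a..b, truncation q a z = ∫ z in a..b, (0 : ℝ) := by
    refine integral_congr fun z hz => ?_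
    rw [Set.uIcc_of_le hab] at hz
    exact truncation_eq_zero (hz.1.trans (le_abs_self z))
  rw [this]
  simp

lemma integral_truncation_eq (hq : Continuous q) {a : ℝ} (ha : 0 ≤ a) :
    ∫ z in (0 : ℝ)..a, truncation q a z = (∫ z in (0 : ℝ)..a, q z) - a * q a := by
  have : ∫ z in (0 : ℝ)..a, truncation q a z = ∫ z in (0 : ℝ)..a, (q z - q a) := by
    refine integral_congr fun z hz => ?_
    rw [Set.uIcc_of_le ha] at hz
    simp [truncation, abs_of_nonneg hz.1, hz.2]
  rw [this, integral_sub (hq.intervalIntegrable _ _) (by simp)]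
  simp

/-- If the only odd compactly supported perturbation of the convex function `η` in both directions
is zero, then every even perturbation is constant. -/
theorem even_perturbation_eq_const {η δ : ℝ → ℝ} (hη : Differentiable ℝ η)
    (hδ : Differentiable ℝ δ) (hp : ConvexOn ℝ Set.univ (fun s => η s + δ s))
    (hm : ConvexOn ℝ Set.univ (fun s => η s - δ s)) (heven : ∀ s, δ (-s) = δ s)
    (hrigid : ∀ γ : ℝ → ℝ, Differentiable ℝ γ → (∀ s, γ (-s) = -γ s) →
      (∃ M, ∀ s, M ≤ |s| → γ s = 0) → ConvexOn ℝ Set.univ (fun s => η s + γ s) →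
      ConvexOn ℝ Set.univ (fun s => η s - γ s) → ∀ s, γ s = 0) (s : ℝ) : δ s = δ 0 := by
  set q := deriv δ with hq_def
  set e := deriv η with he_def
  have hdp : ∀ z, deriv (fun s => η s + δ s) z = e z + q z := fun z => deriv_fun_add (hη z) (hδ z)
  have hdm : ∀ z, deriv (fun s => η s - δ s) z = e z - q z := fun z => deriv_fun_sub (hη z) (hδ z)
  have hmp : Monotone (deriv fun s => η s + δ s) :=
    monotoneOn_univ.1 (hp.monotoneOn_deriv fun x _ => (hη x).add (hδ x))
  have hmm : Monotone (deriv fun s => η s - δ s) :=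
    monotoneOn_univ.1 (hm.monotoneOn_deriv fun x _ => (hη x).sub (hδ x))
  -- Convexity of `η + δ` and of `η - δ` together say that increments of `q` are dominated by those
  -- of `e`.
  have hdom : ∀ x y, x ≤ y → |q y - q x| ≤ e y - e x := by
    intro x y hxy
    have h1 := hmp hxy
    have h2 := hmm hxy
    rw [hdp, hdp] at h1
    rw [hdm, hdm] at h2
    exact abs_le.2 ⟨by linarith, by linarith⟩
  have hqc : Continuous q := by
    have h1 := hp.continuous_deriv_of_differentiable (hη.add hδ)
    have h2 := hm.continuous_deriv_of_differentiable (hη.sub hδ)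
    have : q = fun z => (1 / 2) * (deriv (fun s => η s + δ s) z - deriv (fun s => η s - δ s) z) := by
      funext z
      rw [hdp, hdm]; ring
    rw [this]
    fun_prop
  have hodd : ∀ z, q (-z) = -q z := by
    intro z
    have h1 : (fun s => δ (-s)) = δ := funext heven
    have h2 := deriv_comp_neg δ z
    rw [h1] at h2
    rw [hq_def]
    linarith
  set I : ℝ → ℝ := fun a => ∫ z in (0 : ℝ)..a, truncation q a z with hI
  -- A combination of two truncations with total integral zero has a primitive that is odd and
  -- vanishes beyond `max a b`. Scaled by `N⁻¹` its derivative is still dominated by `e`, so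
  -- rigidity kills the primitive, hence the combination.
  have key : ∀ a b c₁ c₂ : ℝ, 0 ≤ a → 0 ≤ b → c₁ * I a + c₂ * I b = 0 →
      ∀ z, c₁ * truncation q a z + c₂ * truncation q b z = 0 := by
    intro a b c₁ c₂ ha hb hc z
    set N := |c₁| + |c₂| + 1 with hN
    have hNpos : 0 < N := by positivity
    set g : ℝ → ℝ := fun z => N⁻¹ * (c₁ * truncation q a z + c₂ * truncation q b z) with hg
    have hca := continuous_truncation hqc a
    have hcb := continuous_truncation hqc b
    have hgc : Continuous g := by fun_prop
    have hgdom : ∀ x y, x ≤ y → |g y - g x| ≤ e y - e x := by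
      intro x y hxy
      have h1 := abs_truncation_sub_le hodd hdom (a := a) hxy
      have h2 := abs_truncation_sub_le hodd hdom (a := b) hxy
      have h3 : g y - g x = N⁻¹ * (c₁ * (truncation q a y - truncation q a x) +
          c₂ * (truncation q b y - truncation q b x)) := by simp only [hg]; ring
      rw [h3, abs_mul, abs_of_pos (inv_pos.2 hNpos), inv_mul_le_iff₀ hNpos]
      refine (abs_add_le _ _).trans ?_
      rw [abs_mul, abs_mul]
      have h4 := mul_le_mul_of_nonneg_left h1 (abs_nonneg c₁)
      have h5 := mul_le_mul_of_nonneg_left h2 (abs_nonneg c₂)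
      have h6 := (abs_nonneg _).trans h1
      rw [hN]
      linarith
    set γ : ℝ → ℝ := fun z => ∫ x in (0 : ℝ)..z, g x with hγ
    have hγd : ∀ z, HasDerivAt γ (g z) z := fun z => hgc.integral_hasStrictDerivAt 0 z |>.hasDerivAt
    have hγodd : ∀ s, γ (-s) = -γ s := by
      intro s
      have h1 := integral_comp_neg (a := 0) (b := s) g
      have h2 : (fun x => g (-x)) = g := by
        funext x
        simp only [hg, truncation_neg]
      rw [neg_zero] at h1
      simp only [h2] at h1
      simp only [hγ]
      rw [h1, integral_symm]
    have hγpos : ∀ s, max a b ≤ s → γ s = 0 := by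
      intro s hs
      simp only [hγ, hg]
      rw [integral_const_mul, integral_add ((hca.const_mul _).intervalIntegrable _ _)
        ((hcb.const_mul _).intervalIntegrable _ _), integral_const_mul, integral_const_mul,
        integral_truncation_of_le hqc ((le_max_left a b).trans hs),
        integral_truncation_of_le hqc ((le_max_right a b).trans hs)]
      rw [show c₁ * (∫ z in (0 : ℝ)..a, truncation q a z) +
        c₂ * (∫ z in (0 : ℝ)..b, truncation q b z) = 0 from hc, mul_zero]
    have hγ0 := hrigid γ (fun z => (hγd z).differentiableAt) hγodd ⟨max a b, fun s hs => ?_⟩ ?_ ?_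
    · have h1 : HasDerivAt γ 0 z := by
        rw [show γ = fun _ => 0 from funext hγ0]
        exact hasDerivAt_const z 0
      have h2 := (hγd z).unique h1
      simp only [hg] at h2
      exact (mul_eq_zero.1 h2).resolve_left (inv_pos.2 hNpos).ne'
    · rcases le_total 0 s with h0 | h0
      · exact hγpos s (by rwa [abs_of_nonneg h0] at hs)
      · have h1 := hγpos (-s) (by rwa [abs_of_nonpos h0] at hs)
        rw [hγodd] at h1
        linarith
    · refine Monotone.convexOn_univ_of_deriv (fun z => (hη z).add (hγd z).differentiableAt) ?_
      intro x y hxy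
      rw [deriv_fun_add (hη x) (hγd x).differentiableAt, deriv_fun_add (hη y) (hγd y).differentiableAt,
        (hγd x).deriv, (hγd y).deriv]
      have := (abs_le.1 (hgdom x y hxy)).1
      linarith
    · refine Monotone.convexOn_univ_of_deriv (fun z => (hη z).sub (hγd z).differentiableAt) ?_
      intro x y hxy
      rw [deriv_fun_sub (hη x) (hγd x).differentiableAt, deriv_fun_sub (hη y) (hγd y).differentiableAt,
        (hγd x).deriv, (hγd y).deriv]
      have := (abs_le.1 (hgdom x y hxy)).2
      linarith
  set J : ℝ → ℝ := fun a => (∫ z in (0 : ℝ)..a, q z) - a * q a with hJ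
  have hIJ : ∀ a, 0 ≤ a → I a = J a := fun a ha => integral_truncation_eq hqc ha
  have hJc : Continuous J := by
    have : Continuous fun a => ∫ z in (0 : ℝ)..a, q z :=
      continuous_iff_continuousAt.2 fun a =>
        (hqc.integral_hasStrictDerivAt 0 a).hasDerivAt.continuousAt
    fun_prop
  -- With weights `I c` and `-I a` the integrals cancel. At points `z` between `a` and `c` the
  -- truncation at `a` vanishes, so the one at `c` must vanish too: `q` is constant from `a`
  -- onwards.
  have hconst : ∀ a b, 0 ≤ a → a ≤ b → I a ≠ 0 → q b = q a ∧ I b = I a := by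
    intro a b ha hab hIa
    have hcst : ∀ c z, a ≤ z → z ≤ c → q z = q c := by
      intro c z haz hzc
      have h1 := key a c (I c) (-I a) ha (ha.trans (haz.trans hzc)) (by ring) z
      have hz : |z| = z := abs_of_nonneg (ha.trans haz)
      rw [truncation_eq_zero (by rwa [hz])] at h1
      have h2 : truncation q c z = 0 := by
        have : I a * truncation q c z = 0 := by linarith
        exact (mul_eq_zero.1 this).resolve_left hIa
      simp only [truncation, hz, min_eq_left hzc] at h2
      linarith
    refine ⟨(hcst b a le_rfl hab).symm, ?_⟩
    have h1 : ∀ z, truncation q b z = truncation q a z := by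
      intro z
      simp only [truncation, hcst b a le_rfl hab]
      rcases le_total |z| a with h | h
      · rw [min_eq_left h, min_eq_left (h.trans hab)]
      · rw [min_eq_right h, hcst b _ (le_min h hab) (min_le_right _ _), ← hcst b a le_rfl hab]
    simp only [hI, h1]
    exact integral_truncation_of_le hqc hab
  -- A nonzero value `I a` would be preceded, by continuity and `J 0 = 0`, by the value `I a / 2` at
  -- some `a' ≤ a`; but `I` no longer changes once it is nonzero.
  have hI0 : ∀ a, 0 ≤ a → I a = 0 := by
    intro a ha
    by_contra hne
    have h0 : J 0 = 0 := by simp [hJ]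
    have hmem : I a / 2 ∈ Set.uIcc (J 0) (J a) := by
      rw [h0, ← hIJ a ha, Set.mem_uIcc]
      rcases le_total 0 (I a) with h | h
      · left; constructor <;> linarith
      · right; constructor <;> linarith
    obtain ⟨a', ha', ha'I⟩ := intermediate_value_uIcc hJc.continuousOn hmem
    rw [Set.uIcc_of_le ha] at ha'
    rw [← hIJ a' ha'.1] at ha'I
    have := (hconst a' a ha'.1 ha'.2 (by rw [ha'I]; simpa using hne)).2
    rw [ha'I] at this
    exact hne (by linarith)
  have hq0 : q 0 = 0 := by
    have := hodd 0
    rw [neg_zero] at this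
    linarith
  have hqpos : ∀ a, 0 ≤ a → q a = 0 := by
    intro a ha
    -- Since `I a = 0`, a single truncation is already admissible; at `0` it equals `q 0 - q a`.
    have h1 := key a a 1 0 ha ha (by simp [hI0 a ha]) 0
    simp only [truncation, abs_zero, min_eq_left ha, hq0] at h1
    linarith
  have hqz : ∀ a, q a = 0 := by
    intro a
    rcases le_total 0 a with h | h
    · exact hqpos a h
    · have h1 := hqpos (-a) (by linarith)
      rw [hodd] at h1
      linarith
  exact is_const_of_deriv_eq_zero hδ hqz s 0

end TruncatedDerivative

/-! ### Coordinates with respect to an axis. -/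

section InnerProduct

variable {E F : Type*} [NormedAddCommGroup E] [InnerProductSpace ℝ E]
  [NormedAddCommGroup F] [InnerProductSpace ℝ F]

/-- The component of `v` orthogonal to the unit vector `w`. -/
def perp (w v : E) : E := v - (inner ℝ w v : ℝ) • w

lemma perp_add_smul (w v : E) : perp w v + (inner ℝ w v : ℝ) • w = v := by simp [perp]

lemma inner_perp {w : E} (hw : ‖w‖ = 1) (v : E) : inner ℝ w (perp w v) = 0 := by
  simp [perp, inner_sub_right, inner_smul_right, hw]

lemma perp_add (w v v' : E) : perp w (v + v') = perp w v + perp w v' := by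
  simp only [perp, inner_add_right, add_smul]; abel

lemma perp_smul (w v : E) (c : ℝ) : perp w (c • v) = c • perp w v := by
  simp only [perp, inner_smul_right, smul_sub, smul_smul]

lemma perp_neg (w v : E) : perp w (-v) = -perp w v := by
  simp only [perp, inner_neg_right, neg_smul]; abel

lemma perp_combination {w m : E} (hw : ‖w‖ = 1) (hmw : inner ℝ w m = 0) (r z : ℝ) :
    perp w (r • m + z • w) = r • m := by
  simp [perp, inner_add_right, inner_smul_right, hmw, hw]

lemma inner_combination {w m : E} (hw : ‖w‖ = 1) (hmw : inner ℝ w m = 0) (r z : ℝ) :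
    inner ℝ w (r • m + z • w) = z := by
  simp [inner_add_right, inner_smul_right, hmw, hw]

/-- Cylindrical coordinates; the given `m` only supplies a direction when `v` lies on the axis. -/
lemma exists_unit_perp {w m : E} (hm : ‖m‖ = 1) (hw : ‖w‖ = 1) (hmw : inner ℝ w m = 0) (v : E) :
    ∃ m' : E, ‖m'‖ = 1 ∧ inner ℝ w m' = 0 ∧ v = ‖perp w v‖ • m' + (inner ℝ w v : ℝ) • w := by
  rcases eq_or_ne (perp w v) 0 with h | h
  · refine ⟨m, hm, hmw, ?_⟩
    rw [h, norm_zero, zero_smul]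
    nth_rewrite 1 [← perp_add_smul w v]
    rw [h]
  · have hn : ‖perp w v‖ ≠ 0 := norm_ne_zero_iff.2 h
    refine ⟨‖perp w v‖⁻¹ • perp w v, ?_, ?_, ?_⟩
    · rw [norm_smul, norm_inv, norm_norm, inv_mul_cancel₀ hn]
    · rw [inner_smul_right, inner_perp hw, mul_zero]
    · rw [smul_smul, mul_inv_cancel₀ hn, one_smul, perp_add_smul]

lemma exists_unit_orthogonal [FiniteDimensional ℝ E] (S : Submodule ℝ E)
    (hS : Module.finrank ℝ S < Module.finrank ℝ E) :
    ∃ n : E, ‖n‖ = 1 ∧ ∀ x ∈ S, inner ℝ x n = 0 := by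
  have h1 := S.finrank_add_finrank_orthogonal
  have h2 : Sᗮ ≠ ⊥ := by
    intro h
    rw [h, finrank_bot] at h1
    omega
  obtain ⟨x, hx, hx0⟩ := Submodule.exists_mem_ne_zero_of_ne_bot h2
  have hn : ‖x‖ ≠ 0 := norm_ne_zero_iff.2 hx0
  refine ⟨‖x‖⁻¹ • x, by rw [norm_smul, norm_inv, norm_norm, inv_mul_cancel₀ hn], fun y hy => ?_⟩
  rw [inner_smul_right, (Submodule.mem_orthogonal _ _).1 hx y hy, mul_zero]

lemma exists_unit_inner_eq_zero [FiniteDimensional ℝ E] (hE : 2 ≤ Module.finrank ℝ E) (w : E) :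
    ∃ m : E, ‖m‖ = 1 ∧ inner ℝ w m = 0 := by
  obtain ⟨m, hm, h⟩ := exists_unit_orthogonal (Submodule.span ℝ {w})
    (by
      have h := finrank_span_finset_le_card (R := ℝ) ({w} : Finset E)
      rw [Set.finrank, Finset.coe_singleton, Finset.card_singleton] at h
      omega)
  exact ⟨m, hm, h w (Submodule.mem_span_singleton_self w)⟩

lemma eq_combination_of_finrank_eq_two [FiniteDimensional ℝ E] (hE : Module.finrank ℝ E = 2)
    {e f : E} (he : ‖e‖ = 1) (hf : ‖f‖ = 1) (hef : inner ℝ e f = 0) (u : E) :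
    u = (inner ℝ f u : ℝ) • f + (inner ℝ e u : ℝ) • e := by
  have hon : Orthonormal ℝ ![f, e] := by
    rw [orthonormal_iff_ite]
    intro i j
    fin_cases i <;> fin_cases j <;>
      simp [he, hf, hef, real_inner_comm]
  let b := (basisOfOrthonormalOfCardEqFinrank hon (by simp [hE])).toOrthonormalBasis
    (by simpa using hon)
  have hb : ∀ i, b i = ![f, e] i := fun i => by simp [b]
  have := b.sum_repr' u
  simp only [Fin.sum_univ_two, hb] at this
  simpa using this.symm

lemma exists_line_param (L : AffineSubspace ℝ E) (hL : Module.finrank ℝ L.direction = 1) :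
    ∃ a w : E, ‖w‖ = 1 ∧ L.direction = Submodule.span ℝ {w} ∧ a ∈ L ∧
      ∀ x, x ∈ L ↔ ∃ c : ℝ, x = a + c • w := by
  have hne : (L : Set E).Nonempty := by
    rw [AffineSubspace.nonempty_iff_ne_bot]
    rintro rfl
    rw [AffineSubspace.direction_bot, finrank_bot] at hL
    exact zero_ne_one hL
  obtain ⟨a, ha⟩ := hne
  obtain ⟨v, hv, hspan⟩ := finrank_eq_one_iff'.1 hL
  have hn : ‖(v : E)‖ ≠ 0 := norm_ne_zero_iff.2 (by simpa using hv)
  have hdir : L.direction = Submodule.span ℝ {‖(v : E)‖⁻¹ • (v : E)} := by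
    refine le_antisymm (fun x hx => ?_) ?_
    · obtain ⟨c, hc⟩ := hspan ⟨x, hx⟩
      refine Submodule.mem_span_singleton.2 ⟨c * ‖(v : E)‖, ?_⟩
      have := congrArg Subtype.val hc
      simp only [Submodule.coe_smul] at this
      rw [smul_smul, mul_assoc, mul_inv_cancel₀ hn, mul_one, this]
    · rw [Submodule.span_singleton_le_iff_mem]
      exact L.direction.smul_mem _ v.2
  have hnorm : ‖‖(v : E)‖⁻¹ • (v : E)‖ = 1 := by
    rw [norm_smul, norm_inv, norm_norm, inv_mul_cancel₀ hn]
  generalize ‖(v : E)‖⁻¹ • (v : E) = w at hdir hnorm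
  refine ⟨a, w, hnorm, hdir, ha, fun x => ?_⟩
  rw [← AffineSubspace.vsub_right_mem_direction_iff_mem ha, hdir, Submodule.mem_span_singleton]
  refine exists_congr fun c => ?_
  rw [vsub_eq_sub, eq_sub_iff_add_eq, add_comm, eq_comm]

lemma reflection_combination (l : AffineSubspace ℝ E) [Nonempty l]
    [l.direction.HasOrthogonalProjection] {p e f : E} (hp : p ∈ l)
    (hdir : l.direction = Submodule.span ℝ {e}) (hef : inner ℝ e f = 0) (r z : ℝ) :
    EuclideanGeometry.reflection l (p + (r • f + z • e)) = p + ((-r) • f + z • e) := by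
  have he : e ∈ l.direction := hdir ▸ Submodule.mem_span_singleton_self e
  have hf : f ∈ l.directionᗮ := by
    rw [hdir]
    exact Submodule.mem_orthogonal_singleton_iff_inner_right.2 hef
  rw [EuclideanGeometry.reflection_apply_of_mem l _ hp, vsub_eq_sub, add_sub_cancel_left, map_add,
    map_smul, map_smul, Submodule.reflection_mem_subspace_eq_self he,
    Submodule.reflection_mem_subspace_orthogonalComplement_eq_neg hf, vadd_eq_add, smul_neg,
    neg_smul, add_comm]

end InnerProduct

/-! ### Rotations of space about a line. -/

section Rotation

local notation "E3" => EuclideanSpace ℝ (Fin 3)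

/-- Compose two reflections in planes: the first contains `m` and `w` and fixes both, the second is
orthogonal to `m - m'`, so it fixes `w` and sends `m` to `m'`. The two determinants `-1` cancel. -/
lemma exists_linear_rotation {w m m' : E3} (hm : ‖m‖ = 1) (hm' : ‖m'‖ = 1)
    (hwm : inner ℝ w m = 0) (hwm' : inner ℝ w m' = 0) :
    ∃ R : E3 ≃ₗᵢ[ℝ] E3, R w = w ∧ R m = m' ∧
      LinearMap.det (R.toLinearEquiv : E3 →ₗ[ℝ] E3) = 1 := by
  rcases eq_or_ne m m' with rfl | hne
  · refine ⟨LinearIsometryEquiv.refl ℝ E3, rfl, rfl, ?_⟩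
    exact LinearMap.det_id
  obtain ⟨n, hn, hperp⟩ := exists_unit_orthogonal (Submodule.span ℝ {m, w})
    (by
      have h1 := finrank_span_finset_le_card (R := ℝ) ({m, w} : Finset E3)
      have h2 := Finset.card_le_two (a := m) (b := w)
      rw [Set.finrank, Finset.coe_pair] at h1
      rw [finrank_euclideanSpace_fin]
      omega)
  have hmn : inner ℝ m n = 0 := hperp m (Submodule.subset_span (by simp))
  have hwn : inner ℝ w n = 0 := hperp w (Submodule.subset_span (by simp))
  have hn0 : n ≠ 0 := by rintro rfl; simp at hn
  have hdet : ∀ x : E3, x ≠ 0 →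
      LinearMap.det ((Submodule.span ℝ {x})ᗮ.reflection.toLinearEquiv : E3 →ₗ[ℝ] E3) = -1 := by
    intro x hx
    have := (Submodule.span ℝ {x})ᗮ.det_reflection
    rw [Submodule.orthogonal_orthogonal, finrank_span_singleton hx, pow_one] at this
    exact this
  have hfix : ∀ x y : E3, inner ℝ y x = 0 → (Submodule.span ℝ {x})ᗮ.reflection y = y := by
    intro x y hxy
    refine Submodule.reflection_mem_subspace_eq_self ?_
    rw [Submodule.mem_orthogonal_singleton_iff_inner_right, real_inner_comm, hxy]
  refine ⟨(Submodule.span ℝ {n})ᗮ.reflection.trans (Submodule.span ℝ {m - m'})ᗮ.reflection,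
    ?_, ?_, ?_⟩
  · rw [LinearIsometryEquiv.trans_apply, hfix n w hwn, hfix]
    rw [inner_sub_right, hwm, hwm', sub_zero]
  · rw [LinearIsometryEquiv.trans_apply, hfix n m hmn, Submodule.reflection_sub (hm.trans hm'.symm)]
  · have : (((Submodule.span ℝ {n})ᗮ.reflection.trans
        (Submodule.span ℝ {m - m'})ᗮ.reflection).toLinearEquiv : E3 →ₗ[ℝ] E3) =
        ((Submodule.span ℝ {m - m'})ᗮ.reflection.toLinearEquiv : E3 →ₗ[ℝ] E3) ∘ₗ
        ((Submodule.span ℝ {n})ᗮ.reflection.toLinearEquiv : E3 →ₗ[ℝ] E3) := rfl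
    rw [this, LinearMap.det_comp, hdet _ hn0, hdet _ (sub_ne_zero.2 hne)]
    norm_num

variable {L : AffineSubspace ℝ E3} {a w : E3}

lemma exists_rotationAbout (hL : ∀ x, x ∈ L ↔ ∃ c : ℝ, x = a + c • w) {m m' : E3} (hm : ‖m‖ = 1)
    (hm' : ‖m'‖ = 1) (hwm : inner ℝ w m = 0) (hwm' : inner ℝ w m' = 0) :
    ∃ g, IsRotationAbout L g ∧ ∀ r z : ℝ, g (a + (r • m + z • w)) = a + (r • m' + z • w) := by
  obtain ⟨R, hRw, hRm, hR⟩ := exists_linear_rotation hm hm' hwm hwm'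
  refine ⟨AffineIsometryEquiv.mk' (fun x => a + R (x - a)) R a (fun x => ?_), ⟨?_, ?_⟩, ?_⟩
  · simp [add_comm]
  · intro x hx
    obtain ⟨c, rfl⟩ := (hL x).1 hx
    simp [hRw]
  · rw [AffineIsometryEquiv.linearIsometryEquiv_mk']
    exact hR
  · intro r z
    simp [hRw, hRm]

lemma IsRotationAbout.exists_apply_eq (hL : ∀ x, x ∈ L ↔ ∃ c : ℝ, x = a + c • w) {m : E3}
    (hm : ‖m‖ = 1) (hwm : inner ℝ w m = 0) {g : E3 ≃ᵃⁱ[ℝ] E3} (hg : IsRotationAbout L g) :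
    ∃ m' : E3, ‖m'‖ = 1 ∧ inner ℝ w m' = 0 ∧
      ∀ r z : ℝ, g (a + (r • m + z • w)) = a + (r • m' + z • w) := by
  have hga : g a = a := hg.1 a ((hL a).2 ⟨0, by simp⟩)
  have hform : ∀ v, g (a + v) = a + g.linearIsometryEquiv v := fun v => by
    have := g.map_vadd a v
    rw [vadd_eq_add, vadd_eq_add, hga] at this
    rw [add_comm, this, add_comm]
  have hgw : g.linearIsometryEquiv w = w := by
    have h1 := hg.1 (a + w) ((hL _).2 ⟨1, by simp⟩)
    rw [hform] at h1
    exact add_left_cancel h1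
  refine ⟨g.linearIsometryEquiv m, by rw [LinearIsometryEquiv.norm_map, hm], ?_, fun r z => ?_⟩
  · have := g.linearIsometryEquiv.inner_map_map w m
    rwa [hgw, hwm] at this
  · rw [hform, map_add, map_smul, map_smul, hgw]

end Rotation

/-! ### Profiles and bodies of revolution. -/

section Generation

local notation "E2" => EuclideanSpace ℝ (Fin 2)
local notation "E3" => EuclideanSpace ℝ (Fin 3)

/-- `k` is the support function of the body obtained by rotation, about an axis of direction `w`
through the origin, of the planar body with support function `h`, which is symmetric about the line
of direction `e` through the origin; `f` is the direction orthogonal to `e`. -/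
structure IsRotationOf (k : E3 → ℝ) (h : E2 → ℝ) (w : E3) (e f : E2) : Prop where
  norm_w : ‖w‖ = 1
  norm_e : ‖e‖ = 1
  norm_f : ‖f‖ = 1
  inner_e_f : inner ℝ e f = 0
  even : ∀ r z : ℝ, h ((-r) • f + z • e) = h (r • f + z • e)
  apply_eq : ∀ v, k v = h (‖perp w v‖ • f + (inner ℝ w v : ℝ) • e)

/-- Among the rotated copies of a profile point, the product with `v` is largest in the half-plane
of `v` bounded by the axis; symmetry of `C` allows taking the radial coordinate nonnegative. So the
maximum over `K` is a maximum over the profile. -/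
lemma Generates.exists_isRotationOf {C : ConvexBody E2} {K : ConvexBody E3} (hCK : Generates C K) :
    ∃ (p e f : E2) (a w : E3), IsRotationOf (fun v => supportFunction K v - inner ℝ a v)
      (fun u => supportFunction C u - inner ℝ p u) w e f := by
  obtain ⟨-, l, hne, j, hl, hrefl, hK⟩ := hCK
  obtain ⟨p, e, he, hdir, hp, hline⟩ := exists_line_param l hl
  obtain ⟨f, hf, hef⟩ := exists_unit_inner_eq_zero (by simp) e
  have hu := eq_combination_of_finrank_eq_two (E := E2) (by simp) he hf hef
  set J := j.linearIsometry with hJ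
  have hj : ∀ v, j (p + v) = j p + J v := fun v => by
    have := j.map_vadd p v
    rw [vadd_eq_add, vadd_eq_add] at this
    rw [add_comm, this, add_comm]
  have hw : ‖J e‖ = 1 := by rw [J.norm_map, he]
  have hm : ‖J f‖ = 1 := by rw [J.norm_map, hf]
  have hwm : inner ℝ (J e) (J f) = 0 := by rw [J.inner_map_map, hef]
  have hL : ∀ x, x ∈ l.map j.toAffineMap ↔ ∃ c : ℝ, x = j p + c • J e := by
    intro x
    rw [AffineSubspace.mem_map]
    constructor
    · rintro ⟨y, hy, rfl⟩
      obtain ⟨c, rfl⟩ := (hline y).1 hy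
      exact ⟨c, by rw [← map_smul, ← hj]; rfl⟩
    · rintro ⟨c, rfl⟩
      exact ⟨p + c • e, (hline _).2 ⟨c, rfl⟩, by rw [← map_smul, ← hj]; rfl⟩
  have hsymm : ∀ r z : ℝ, p + (r • f + z • e) ∈ C → p + ((-r) • f + z • e) ∈ C := by
    intro r z h
    rw [← SetLike.mem_coe, ← hrefl, ← reflection_combination l hp hdir hef]
    exact ⟨_, h, rfl⟩
  have hsup : ∀ r z r' z' : ℝ, p + (r • f + z • e) ∈ C →
      r * r' + z * z' ≤ supportFunction C (r' • f + z' • e) - inner ℝ p (r' • f + z' • e) := by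
    intro r z r' z' h
    have h1 := inner_le_supportFunction C h (r' • f + z' • e)
    have h2 : inner ℝ (r • f + z • e) (r' • f + z' • e) = r * r' + z * z' := by
      have hfe : inner ℝ f e = 0 := by rw [real_inner_comm, hef]
      simp only [inner_add_left, inner_add_right, real_inner_smul_left, real_inner_smul_right,
        real_inner_self_eq_norm_sq, he, hf, hef, hfe]
      ring
    rw [inner_add_left, h2] at h1
    linarith
  have hatt : ∀ r' z' : ℝ, ∃ r z : ℝ, p + (r • f + z • e) ∈ C ∧
      r * r' + z * z' = supportFunction C (r' • f + z' • e) - inner ℝ p (r' • f + z' • e) := by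
    intro r' z'
    obtain ⟨x, hx, hx'⟩ := exists_inner_eq_supportFunction C (r' • f + z' • e)
    refine ⟨inner ℝ f (x - p), inner ℝ e (x - p), ?_, ?_⟩
    · rw [← hu, add_sub_cancel]; exact hx
    · rw [← hx', ← inner_sub_left]
      simp only [inner_add_right, real_inner_smul_right]
      rw [real_inner_comm, real_inner_comm e]
      ring
  have hle : ∀ r' z' : ℝ,
      supportFunction C ((-r') • f + z' • e) - inner ℝ p ((-r') • f + z' • e) ≤
      supportFunction C (r' • f + z' • e) - inner ℝ p (r' • f + z' • e) := by
    intro r' z'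
    obtain ⟨r, z, hrz, hrz'⟩ := hatt (-r') z'
    have := hsup (-r) z r' z' (hsymm r z hrz)
    rw [← hrz']
    linarith
  refine ⟨p, e, f, j p, J e, hw, he, hf, hef, fun r z => le_antisymm (hle r z) ?_, fun v => ?_⟩
  · have := hle (-r) z
    rwa [neg_neg] at this
  obtain ⟨m, hm1, hwm1, hv⟩ := exists_unit_perp hm hw hwm v
  set ρ := ‖perp (J e) v‖ with hρ
  have hρ0 : 0 ≤ ρ := norm_nonneg _
  set ζ : ℝ := inner ℝ (J e) v with hζ
  have hinner : ∀ (m' : E3) (r z : ℝ), inner ℝ (J e) m' = 0 →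
      inner ℝ (r • m' + z • J e) v = r * (ρ * inner ℝ m' m) + z * ζ := by
    intro m' r z hm'
    rw [inner_add_left, real_inner_smul_left, real_inner_smul_left, ← hζ]
    congr 2
    nth_rewrite 1 [hv]
    rw [inner_add_right, real_inner_smul_right, real_inner_smul_right,
      real_inner_comm (J e) m', hm', mul_zero, add_zero]
  have hjp : ∀ r z : ℝ, j (p + (r • f + z • e)) = j p + (r • J f + z • J e) := by
    intro r z
    rw [hj, map_add, map_smul, map_smul]
  have hsupp : supportFunction K v =
      inner ℝ (j p) v + (supportFunction C (ρ • f + ζ • e) - inner ℝ p (ρ • f + ζ • e)) := by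
    refine supportFunction_eq_of K v ?_ ?_
    · intro y hy
      rw [← SetLike.mem_coe, hK] at hy
      obtain ⟨g, hg, x, hx, rfl⟩ := hy
      obtain ⟨m', hm', hwm', hgm⟩ := hg.exists_apply_eq hL hm hwm
      have hxp : x = p + ((inner ℝ f (x - p) : ℝ) • f + (inner ℝ e (x - p) : ℝ) • e) := by
        rw [← hu, add_sub_cancel]
      generalize (inner ℝ f (x - p) : ℝ) = r at hxp
      generalize (inner ℝ e (x - p) : ℝ) = z at hxp
      subst hxp
      rw [hjp, hgm, inner_add_left, hinner m' r z hwm']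
      have h1 : |r| * ρ + z * ζ ≤
          supportFunction C (ρ • f + ζ • e) - inner ℝ p (ρ • f + ζ • e) := by
        rcases abs_choice r with h | h
        · rw [h]; exact hsup r z ρ ζ hx
        · rw [h]; exact hsup (-r) z ρ ζ (hsymm r z hx)
      have h2 : r * (ρ * inner ℝ m' m) ≤ |r| * ρ := by
        have h3 : |(inner ℝ m' m : ℝ)| ≤ 1 := by
          have := abs_real_inner_le_norm m' m
          rwa [hm', hm1, mul_one] at this
        refine (le_abs_self _).trans ?_
        rw [abs_mul, abs_mul, abs_of_nonneg hρ0]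
        refine mul_le_mul_of_nonneg_left ?_ (abs_nonneg r)
        exact mul_le_of_le_one_right hρ0 h3
      linarith
    · obtain ⟨r, z, hrz, hrz'⟩ := hatt ρ ζ
      obtain ⟨g, hg, hgm⟩ := exists_rotationAbout hL hm hm1 hwm hwm1
      refine ⟨j p + (r • m + z • J e), ?_, ?_⟩
      · rw [← SetLike.mem_coe, hK]
        exact ⟨g, hg, _, hrz, by rw [hjp, hgm]⟩
      · rw [inner_add_left, hinner m r z hwm1, real_inner_self_eq_norm_sq, hm1, ← hrz']
        ring
  simp only [hsupp]
  ring

/-- The profile is the section of `K` by a plane through the axis. It has constant width because it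
coincides with the projection of `K` to that plane, so its support function is a restriction of that
of `K`. -/
lemma exists_generates {K : ConvexBody E3} (hK : HasConstantWidth K) (hsym : IsAxiallySymmetric K) :
    ∃ C : ConvexBody E2, Generates C K := by
  obtain ⟨L, hL1, hrot⟩ := hsym
  obtain ⟨a, w, hw, -, -, hL⟩ := exists_line_param L hL1
  obtain ⟨m, hm, hwm⟩ := exists_unit_inner_eq_zero (by simp) w
  have hmw : inner ℝ m w = 0 := by rw [real_inner_comm, hwm]
  obtain ⟨e, he⟩ : ∃ e : E2, ‖e‖ = 1 := ⟨EuclideanSpace.single 0 1, by simp⟩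
  obtain ⟨f, hf, hef⟩ := exists_unit_inner_eq_zero (by simp) e
  have hfe : inner ℝ f e = 0 := by rw [real_inner_comm, hef]
  have hu := eq_combination_of_finrank_eq_two (E := E2) (by simp) he hf hef
  let J₀ : E2 →ₗ[ℝ] E3 :=
    ((innerSL ℝ f).smulRight m + (innerSL ℝ e).smulRight w : E2 →L[ℝ] E3)
  have hJ₀ : ∀ u, J₀ u = (inner ℝ f u : ℝ) • m + (inner ℝ e u : ℝ) • w := fun u => rfl
  have hpyth : ∀ (x y : ℝ), ‖x • m + y • w‖ ^ 2 = ‖x • f + y • e‖ ^ 2 := by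
    intro x y
    simp only [← real_inner_self_eq_norm_sq, inner_add_left, inner_add_right, real_inner_smul_left,
      real_inner_smul_right, hwm, hmw, hef, hfe]
    simp only [real_inner_self_eq_norm_sq, hw, hm, he, hf]
  let J : E2 →ₗᵢ[ℝ] E3 := ⟨J₀, fun u => by
    rw [← sq_eq_sq₀ (norm_nonneg _) (norm_nonneg _), hJ₀, hpyth, ← hu]⟩
  have hJ : ∀ u, J u = (inner ℝ f u : ℝ) • m + (inner ℝ e u : ℝ) • w := hJ₀
  let j : E2 →ᵃⁱ[ℝ] E3 :=
    (AffineIsometryEquiv.vaddConst ℝ a).toAffineIsometry.comp J.toAffineIsometry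
  have hj : ∀ u, j u = a + J u := fun u => add_comm _ _
  have hjc : ∀ r z : ℝ, j (r • f + z • e) = a + (r • m + z • w) := by
    intro r z
    rw [hj, hJ, inner_combination he hef, add_comm (r • f), inner_combination hf hfe]
  have hmove : ∀ {m₁ m₂ : E3} (r z : ℝ), ‖m₁‖ = 1 → ‖m₂‖ = 1 → inner ℝ w m₁ = 0 →
      inner ℝ w m₂ = 0 → a + (r • m₁ + z • w) ∈ K → a + (r • m₂ + z • w) ∈ K := by
    intro m₁ m₂ r z h1 h2 hw1 hw2 hmem
    obtain ⟨g, hg, hg'⟩ := exists_rotationAbout hL h1 h2 hw1 hw2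
    rw [← SetLike.mem_coe, ← hrot g hg, ← hg']
    exact ⟨_, hmem, rfl⟩
  have hneg : ‖-m‖ = 1 ∧ inner ℝ w (-m) = 0 := by simp [hm, hwm]
  have hdecomp : ∀ y : E3, ∃ (m' : E3) (r z : ℝ), ‖m'‖ = 1 ∧ inner ℝ w m' = 0 ∧
      y = a + (r • m' + z • w) := by
    intro y
    obtain ⟨m', h1, h2, h3⟩ := exists_unit_perp hm hw hwm (y - a)
    exact ⟨m', _, _, h1, h2, by rw [← h3, add_sub_cancel]⟩
  -- The rotated copies of a point in the directions `m` and `-m` lie in `K`, and so does the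
  -- segment between them. With `t = ⟪m', m⟫` this puts the projection of the point in the section;
  -- `t = 0` gives nonemptiness.
  have hshrink : ∀ {m' : E3} (r z t : ℝ), ‖m'‖ = 1 → inner ℝ w m' = 0 → |t| ≤ 1 →
      a + (r • m' + z • w) ∈ K → j ((r * t) • f + z • e) ∈ K := by
    intro m' r z t h1 h2 ht hmem
    have h3 := hmove r z h1 hm h2 hwm hmem
    have h4 := hmove r z h1 hneg.1 h2 hneg.2 hmem
    obtain ⟨ht1, ht2⟩ := abs_le.1 ht
    have := K.convex h3 h4 (a := (1 + t) / 2) (b := (1 - t) / 2) (by linarith) (by linarith)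
      (by ring)
    have h5 : ((1 + t) / 2) • (a + (r • m + z • w)) + ((1 - t) / 2) • (a + (r • -m + z • w)) =
        a + ((r * t) • m + z • w) := by module
    rw [h5] at this
    rw [hjc]
    exact this
  let C : ConvexBody E2 := ⟨j ⁻¹' K, K.convex.affine_preimage j.toAffineMap,
    j.isometry.isClosedEmbedding.isCompact_preimage K.isCompact, by
      obtain ⟨y, hy⟩ := K.nonempty
      obtain ⟨m', r, z, h1, h2, rfl⟩ := hdecomp y
      exact ⟨_, hshrink r z 0 h1 h2 (by simp) hy⟩⟩
  have hmemC : ∀ x, x ∈ C ↔ j x ∈ K := fun x => Iff.rfl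
  have hsupp : ∀ u, supportFunction C u = supportFunction K (J u) - inner ℝ a (J u) := by
    intro u
    refine supportFunction_eq_of C u ?_ ?_
    · intro x hx
      have := inner_le_supportFunction K ((hmemC x).1 hx) (J u)
      rw [hj, inner_add_left, J.inner_map_map] at this
      linarith
    · obtain ⟨y, hy, hy'⟩ := exists_inner_eq_supportFunction K (J u)
      obtain ⟨m', r, z, h1, h2, rfl⟩ := hdecomp y
      have h3 : |(inner ℝ m' m : ℝ)| ≤ 1 := by
        have := abs_real_inner_le_norm m' m
        rwa [h1, hm, mul_one] at this
      refine ⟨(r * inner ℝ m' m) • f + z • e, hshrink r z _ h1 h2 h3 hy, ?_⟩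
      have h4 : inner ℝ m' w = 0 := by rw [real_inner_comm, h2]
      rw [← hy', hJ]
      simp only [inner_add_left, inner_add_right, real_inner_smul_left, real_inner_smul_right, hwm,
        h4, real_inner_self_eq_norm_sq, hw]
      ring
  let l : AffineSubspace ℝ E2 := (Submodule.span ℝ {e}).toAffineSubspace
  have hldir : l.direction = Submodule.span ℝ {e} := Submodule.toAffineSubspace_direction _
  have h0l : (0 : E2) ∈ l := (Submodule.span ℝ {e}).zero_mem
  have hne : Nonempty l := ⟨⟨0, h0l⟩⟩
  have he0 : e ≠ 0 := by rintro rfl; simp at he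
  have hmap : l.map j.toAffineMap = L := by
    ext x
    rw [AffineSubspace.mem_map, hL]
    have hje : ∀ c : ℝ, j (c • e) = a + c • w := fun c => by simpa using hjc 0 c
    constructor
    · rintro ⟨y, hy, rfl⟩
      obtain ⟨c, rfl⟩ := Submodule.mem_span_singleton.1 hy
      exact ⟨c, hje c⟩
    · rintro ⟨c, rfl⟩
      exact ⟨c • e, Submodule.mem_span_singleton.2 ⟨c, rfl⟩, hje c⟩
  refine ⟨C, fun u hu1 => ?_, l, hne, j, ?_, ?_, ?_⟩
  · rw [hsupp, hsupp, map_neg, inner_neg_right]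
    have := hK (J u) (by rw [J.norm_map, hu1])
    linarith
  · rw [hldir, finrank_span_singleton he0]
  · have hsub : ∀ x ∈ C, EuclideanGeometry.reflection l x ∈ C := by
      intro x hx
      rw [hu x, hmemC, hjc] at hx
      rw [hu x, ← zero_add (_ + _), reflection_combination l h0l hldir hef, zero_add, hmemC, hjc]
      have := hmove _ _ hm hneg.1 hwm hneg.2 hx
      rwa [smul_neg, ← neg_smul] at this
    refine Set.Subset.antisymm ?_ fun x hx => ?_
    · rintro _ ⟨x, hx, rfl⟩
      exact hsub x hx
    · exact ⟨_, hsub x hx, EuclideanGeometry.reflection_reflection l x⟩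
  · rw [hmap]
    ext y
    constructor
    · intro hy
      obtain ⟨m', r, z, h1, h2, rfl⟩ := hdecomp y
      obtain ⟨g, hg, hg'⟩ := exists_rotationAbout hL hm h1 hwm h2
      refine ⟨g, hg, r • f + z • e, ?_, by rw [hjc, hg']⟩
      rw [hmemC, hjc]
      exact hmove r z h1 hm h2 hwm hy
    · rintro ⟨g, hg, x, hx, rfl⟩
      rw [← hrot g hg]
      exact ⟨_, hx, rfl⟩

end Generation

/-! ### Extremality passes from the profile to the solid. -/

lemma HasWidthOne.add_odd {E : Type*} [NormedAddCommGroup E] [InnerProductSpace ℝ E] {h d : E → ℝ}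
    (hh : HasWidthOne h) (hd : ∀ u, d (-u) = -d u) : HasWidthOne (fun u => h u + d u) := by
  intro u
  simp only [hd]
  linarith [hh u]

lemma HasWidthOne.sub_odd {E : Type*} [NormedAddCommGroup E] [InnerProductSpace ℝ E] {h d : E → ℝ}
    (hh : HasWidthOne h) (hd : ∀ u, d (-u) = -d u) : HasWidthOne (fun u => h u - d u) := by
  intro u
  simp only [hd]
  linarith [hh u]

section ExtremeTransfer

local notation "E2" => EuclideanSpace ℝ (Fin 2)
local notation "E3" => EuclideanSpace ℝ (Fin 3)

variable {k : E3 → ℝ} {h : E2 → ℝ} {w : E3} {e f : E2}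

namespace IsRotationOf

lemma apply_abs (H : IsRotationOf k h w e f) (r z : ℝ) :
    h (|r| • f + z • e) = h (r • f + z • e) := by
  rcases abs_choice r with hr | hr
  · rw [hr]
  · rw [hr, H.even]

lemma apply_combination (H : IsRotationOf k h w e f) {m : E3} (hm : ‖m‖ = 1)
    (hwm : inner ℝ w m = 0) (r z : ℝ) : k (r • m + z • w) = h (r • f + z • e) := by
  rw [H.apply_eq, perp_combination H.norm_w hwm, inner_combination H.norm_w hwm, norm_smul, hm,
    mul_one, Real.norm_eq_abs, H.apply_abs]

/-- If the planar body admits only linear perturbations, so does the body of revolution. -/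
theorem linear_of_planar (H : IsRotationOf k h w e f) (hw1 : HasWidthOne k)
    (hC : ∀ d : E2 → ℝ, (∀ u, d (-u) = -d u) → IsSublinear (fun u => h u + d u) →
      IsSublinear (fun u => h u - d u) → ∃ b : E2, ∀ u, d u = inner ℝ b u)
    {D : E3 → ℝ} (hodd : ∀ v, D (-v) = -D v) (hp : IsSublinear (fun v => k v + D v))
    (hm : IsSublinear (fun v => k v - D v)) : ∃ b : E3, ∀ v, D v = inner ℝ b v := by
  obtain ⟨m₀, hm₀, hwm₀⟩ := exists_unit_inner_eq_zero (E := E3) (by simp) w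
  have hw0 : w ≠ 0 := by
    rintro rfl
    simpa using H.norm_w
  -- On the plane spanned by `m` and `w` the function `k` is a copy of `h`, so the planar hypothesis
  -- applies to the restriction of `D`.
  have hplane : ∀ m : E3, ‖m‖ = 1 → inner ℝ w m = 0 → ∃ b₁ b₂ : ℝ, ∀ r z : ℝ,
      D (r • m + z • w) = r * b₁ + z * b₂ := by
    intro m hm1 hwm
    let T : E2 →ₗ[ℝ] E3 :=
      ((innerSL ℝ f).smulRight m + (innerSL ℝ e).smulRight w : E2 →L[ℝ] E3)
    have hT : ∀ u, T u = (inner ℝ f u : ℝ) • m + (inner ℝ e u : ℝ) • w := fun u => rfl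
    have hkT : ∀ u, k (T u) = h u := fun u => by
      rw [hT, H.apply_combination hm1 hwm, ← eq_combination_of_finrank_eq_two (E := E2) (by simp)
        H.norm_e H.norm_f H.inner_e_f]
    have hp' := hp.comp_linear T
    have hm' := hm.comp_linear T
    simp only [hkT] at hp' hm'
    obtain ⟨b, hb⟩ := hC (fun u => D (T u)) (fun u => by rw [map_neg, hodd]) hp' hm'
    refine ⟨inner ℝ b f, inner ℝ b e, fun r z => ?_⟩
    have h1 := hb (r • f + z • e)
    have hfe : inner ℝ f e = 0 := by rw [real_inner_comm, H.inner_e_f]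
    rw [hT, inner_combination H.norm_e H.inner_e_f, add_comm (r • f) (z • e),
      inner_combination H.norm_f hfe] at h1
    rw [h1, inner_add_right, inner_smul_right, inner_smul_right, add_comm]
  -- `D` is half the difference of `k + D` and `k - D`, both sublinear of width one.
  have hdiff : DifferentiableAt ℝ D w := by
    have h1 := hp.differentiableAt (hw1.add_odd hodd) hw0
    have h2 := hm.differentiableAt (hw1.sub_odd hodd) hw0
    refine ((h1.sub h2).const_mul (1 / 2)).congr_of_eventuallyEq
      (Filter.Eventually.of_forall fun v => ?_)
    simp only [Pi.sub_apply]
    ring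
  refine ⟨(InnerProductSpace.toDual ℝ E3).symm (fderiv ℝ D w), fun v => ?_⟩
  rw [InnerProductSpace.toDual_symm_apply]
  obtain ⟨m, hm1, hwm, hv⟩ := exists_unit_perp hm₀ H.norm_w hwm₀ v
  obtain ⟨b₁, b₂, hb⟩ := hplane m hm1 hwm
  -- `w` and `v` lie in a common plane through the axis, where `D` is linear; so the derivative of
  -- `D` at `w` along `v` is `D v` itself.
  have hline : ∀ t : ℝ, D (w + t • v) = b₂ + t * D v := by
    intro t
    have h1 : w + t • v = (t * ‖perp w v‖) • m + (1 + t * inner ℝ w v) • w := by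
      nth_rewrite 1 [hv]
      module
    have h2 : D v = ‖perp w v‖ * b₁ + inner ℝ w v * b₂ := by
      nth_rewrite 1 [hv]
      exact hb _ _
    rw [h1, hb, h2]
    ring
  have hd1 : HasDerivAt (fun t : ℝ => D (w + t • v)) (fderiv ℝ D w v) 0 := by
    have h1 : HasDerivAt (fun t : ℝ => w + t • v) v 0 := by
      simpa using ((hasDerivAt_id (0 : ℝ)).smul_const v).const_add w
    have h2 : HasFDerivAt D (fderiv ℝ D w) (w + (0 : ℝ) • v) := by
      simpa using hdiff.hasFDerivAt
    exact h2.comp_hasDerivAt (0 : ℝ) h1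
  have hd2 : HasDerivAt (fun t : ℝ => D (w + t • v)) (D v) 0 := by
    rw [funext hline]
    simpa using ((hasDerivAt_id (0 : ℝ)).mul_const (D v)).const_add b₂
  exact hd2.unique hd1

end IsRotationOf

end ExtremeTransfer

/-! ### Lifting perturbations of the profile to space. -/

lemma ConvexOn.tangent_le {φ : ℝ → ℝ} (hφ : ConvexOn ℝ Set.univ φ) (hd : Differentiable ℝ φ)
    (x y : ℝ) : φ x + deriv φ x * (y - x) ≤ φ y := by
  rcases lt_trichotomy x y with h | rfl | h
  · have h1 := hφ.deriv_le_slope (Set.mem_univ x) (Set.mem_univ y) h (hd x)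
    rw [slope_def_field, le_div_iff₀ (by linarith)] at h1
    linarith
  · simp
  · have h1 := hφ.slope_le_deriv (Set.mem_univ y) (Set.mem_univ x) h (hd x)
    rw [slope_def_field, div_le_iff₀ (by linarith)] at h1
    linarith

section Lift

local notation "E2" => EuclideanSpace ℝ (Fin 2)
local notation "E3" => EuclideanSpace ℝ (Fin 3)

variable {k : E3 → ℝ} {h : E2 → ℝ} {w : E3} {e f : E2}

/-- The radial extension of an even planar sublinear function is sublinear. -/
lemma IsSublinear.revolve {g : E2 → ℝ} (hg : IsSublinear g)
    (heven : ∀ r z : ℝ, g ((-r) • f + z • e) = g (r • f + z • e)) :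
    IsSublinear (fun v : E3 => g (‖perp w v‖ • f + (inner ℝ w v : ℝ) • e)) := by
  -- A point with smaller radial coordinate is a convex combination of the mirror points with radial
  -- coordinates `r'` and `-r'`, where `g` takes equal values. Monotonicity lets the triangle
  -- inequality for `perp` be used inside `g`.
  have hmono : ∀ r r' z : ℝ, 0 ≤ r → r ≤ r' → g (r • f + z • e) ≤ g (r' • f + z • e) := by
    intro r r' z hr hrr'
    rcases (hr.trans hrr').eq_or_lt with h0 | h0
    · rw [le_antisymm hrr' (h0 ▸ hr)]
    · set t := r / r' with ht
      have ht1 : t ≤ 1 := (div_le_one h0).2 hrr'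
      have ht0 : 0 ≤ t := div_nonneg hr h0.le
      have h1 := hg.add_le (((1 + t) / 2) • (r' • f + z • e)) (((1 - t) / 2) • ((-r') • f + z • e))
      rw [hg.smul_nonneg (by linarith), hg.smul_nonneg (by linarith), heven] at h1
      have h2 : ((1 + t) / 2) • (r' • f + z • e) + ((1 - t) / 2) • ((-r') • f + z • e) =
          (t * r') • f + z • e := by module
      rw [h2, ht, div_mul_cancel₀ _ h0.ne'] at h1
      linarith
  refine ⟨fun c hc v => ?_, fun v v' => ?_⟩
  · rw [perp_smul, norm_smul, inner_smul_right, Real.norm_of_nonneg hc.le, mul_smul, mul_smul,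
      ← smul_add, hg.smul c hc]
  · rw [perp_add, inner_add_right]
    refine (hmono _ (‖perp w v‖ + ‖perp w v'‖) _ (norm_nonneg _) (norm_add_le _ _)).trans ?_
    rw [add_smul, add_smul, add_add_add_comm]
    exact hg.add_le _ _

/-- The perturbation of the support function of a body of revolution about `w` which corresponds to
the perturbation `γ` of the restriction of the profile to a tangent line. -/
noncomputable def radialPerturbation (w : E3) (γ : ℝ → ℝ) (v : E3) : ℝ :=
  ‖perp w v‖ * γ (inner ℝ w v / ‖perp w v‖)

lemma exists_abs_le_of_vanishing {γ : ℝ → ℝ} (hγ : Continuous γ) {M : ℝ}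
    (hM : ∀ s, M ≤ |s| → γ s = 0) : ∃ B, 0 ≤ B ∧ ∀ s, |γ s| ≤ B := by
  obtain ⟨B, hB⟩ := (isCompact_Icc (a := -M) (b := M)).exists_bound_of_continuousOn
    hγ.continuousOn
  refine ⟨max B 0, le_max_right _ _, fun s => ?_⟩
  rcases le_total M |s| with h | h
  · rw [hM s h, abs_zero]
    exact le_max_right _ _
  · exact (hB s ⟨(abs_le.1 h).1, (abs_le.1 h).2⟩).trans (le_max_left _ _)

/-- Only the axis is critical; there the factor `‖perp w v‖` tends to zero while `γ` stays bounded.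
-/
lemma continuous_radialPerturbation (w : E3) {γ : ℝ → ℝ} (hγ : Continuous γ) {M : ℝ}
    (hM : ∀ s, M ≤ |s| → γ s = 0) : Continuous (radialPerturbation w γ) := by
  have hρ : Continuous fun v : E3 => ‖perp w v‖ := by unfold perp; fun_prop
  have hζ : Continuous fun v : E3 => (inner ℝ w v : ℝ) := by fun_prop
  obtain ⟨B, hB0, hB⟩ := exists_abs_le_of_vanishing hγ hM
  refine continuous_iff_continuousAt.2 fun v => ?_
  by_cases hv : ‖perp w v‖ = 0
  · have h0 : radialPerturbation w γ v = 0 := by rw [radialPerturbation, hv, zero_mul]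
    rw [ContinuousAt, h0]
    refine squeeze_zero_norm (a := fun v => ‖perp w v‖ * B) (fun x => ?_) ?_
    · rw [radialPerturbation, norm_mul, norm_norm]
      exact mul_le_mul_of_nonneg_left (hB _) (norm_nonneg _)
    · have := (hρ.tendsto v).mul_const B
      rwa [hv, zero_mul] at this
  · exact hρ.continuousAt.mul
      (ContinuousAt.comp (g := γ) hγ.continuousAt (hζ.continuousAt.div hρ.continuousAt hv))

lemma radialPerturbation_smul (w : E3) (γ : ℝ → ℝ) {c : ℝ} (hc : 0 < c) (v : E3) :
    radialPerturbation w γ (c • v) = c * radialPerturbation w γ v := by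
  simp only [radialPerturbation, perp_smul, norm_smul, inner_smul_right, Real.norm_of_nonneg hc.le]
  rw [mul_div_mul_left _ _ hc.ne', mul_assoc]

lemma eventually_perp_add_smul_ne_zero {m : E3} (hm : ‖m‖ = 1)
    (hwm : inner ℝ w m = 0) (v : E3) {c : ℝ} (hc : 0 < c) :
    ∀ᶠ t : ℝ in nhdsWithin 0 (Set.Ioi 0), perp w (v + (c * t) • m) ≠ 0 := by
  have hpm : perp w m = m := by simp [perp, hwm]
  have hm0 : m ≠ 0 := by rintro rfl; simp at hm
  by_cases hv : perp w v = 0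
  · filter_upwards [self_mem_nhdsWithin] with t ht
    rw [perp_add, hv, zero_add, perp_smul, hpm]
    exact smul_ne_zero (mul_pos hc ht).ne' hm0
  · refine nhdsWithin_le_nhds ?_
    have hcont : Continuous fun t : ℝ => perp w (v + (c * t) • m) := by unfold perp; fun_prop
    refine hcont.continuousAt.eventually_ne ?_
    simpa using hv

namespace IsRotationOf

/-- Every tangent to a compactly supported perturbation of the profile is nonnegative at `0`. -/
lemma exists_tangent (H : IsRotationOf k h w e f) (hh : IsSublinear h) {γ : ℝ → ℝ} {M : ℝ}
    (hM : ∀ s, M ≤ |s| → γ s = 0) (hconv : ConvexOn ℝ Set.univ (fun s => h (f + s • e) + γ s))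
    (hd : Differentiable ℝ (fun s => h (f + s • e) + γ s)) (s₀ : ℝ) :
    ∃ α β : ℝ, 0 ≤ α ∧ h (f + s₀ • e) + γ s₀ = α + β * s₀ ∧
      ∀ s, α + β * s ≤ h (f + s • e) + γ s := by
  -- Where `γ` vanishes, a supporting vector `p` of `h` gives the tangent, first locally and then
  -- globally by convexity. Evenness of `h` in the radial coordinate forces `⟪p, f⟫ ≥ 0`.
  have hfar : ∀ S, M < |S| → ∃ α β : ℝ, 0 ≤ α ∧ h (f + S • e) + γ S = α + β * S ∧
      ∀ s, α + β * s ≤ h (f + s • e) + γ s := by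
    intro S hS
    obtain ⟨p, hp, hp'⟩ := hh.exists_support (f + S • e)
    have hpl : ∀ s : ℝ, inner ℝ p (f + s • e) = inner ℝ p f + inner ℝ p e * s := fun s => by
      rw [inner_add_right, inner_smul_right, mul_comm]
    refine ⟨inner ℝ p f, inner ℝ p e, ?_, ?_, ?_⟩
    · have h1 := hp' ((-1 : ℝ) • f + S • e)
      rw [H.even, one_smul, ← hp, inner_add_right, inner_add_right, inner_smul_right] at h1
      linarith
    · rw [hM S hS.le, add_zero, ← hp, hpl]
    · have hconv' : ConvexOn ℝ Set.univ
          (fun s => (h (f + s • e) + γ s) + (-(inner ℝ p e * s) + -inner ℝ p f)) := by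
        refine hconv.add ⟨convex_univ, fun x _ y _ a b _ _ hab => le_of_eq ?_⟩
        simp only [smul_eq_mul]
        linear_combination (inner ℝ p f : ℝ) * hab
      have hlocal : IsLocalMin
          (fun s => (h (f + s • e) + γ s) + (-(inner ℝ p e * s) + -inner ℝ p f)) S := by
        have : ∀ᶠ s in nhds S, M < |s| := continuous_abs.continuousAt.eventually_const_lt hS
        filter_upwards [this] with s hs
        have h1 := hp' (f + s • e)
        rw [hM s hs.le, hM S hS.le, ← hp]
        rw [hpl] at h1 ⊢
        linarith
      have hmin := IsMinOn.of_isLocalMin_of_convex_univ hlocal hconv'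
      intro s
      have h1 := hmin s
      rw [hM S hS.le, ← hp, hpl] at h1
      linarith
  set φ : ℝ → ℝ := fun s => h (f + s • e) + γ s with hφ
  have htan : ∀ s, φ s₀ + deriv φ s₀ * (s - s₀) ≤ φ s := fun s => hconv.tangent_le hd s₀ s
  refine ⟨φ s₀ - deriv φ s₀ * s₀, deriv φ s₀, ?_, by ring, fun s => by linarith [htan s]⟩
  -- Choose `S` outside the support of `γ`, on the same side as `s₀` and farther out. Moving the
  -- point of tangency away from `0` cannot raise the intercept, so the one at `s₀` is at least `α ≥
  -- 0`.
  obtain ⟨S, hS, hsgn⟩ : ∃ S : ℝ, M < |S| ∧ (0 ≤ s₀ ∧ s₀ < S ∨ s₀ ≤ 0 ∧ S < s₀) := by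
    have h1 : M < |M| + |s₀| + 1 := by linarith [le_abs_self M, abs_nonneg s₀]
    have h2 : 0 < |M| + |s₀| + 1 := by positivity
    rcases le_total 0 s₀ with h0 | h0
    · refine ⟨|M| + |s₀| + 1, by rwa [abs_of_pos h2], Or.inl ⟨h0, ?_⟩⟩
      linarith [le_abs_self s₀, abs_nonneg M]
    · refine ⟨-(|M| + |s₀| + 1), by rwa [abs_neg, abs_of_pos h2], Or.inr ⟨h0, ?_⟩⟩
      linarith [neg_abs_le s₀, abs_nonneg M]
  obtain ⟨α, β, hα, hαS, hαle⟩ := hfar S hS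
  have h1 := htan S
  have h2 := hαle s₀
  change φ S = _ at hαS
  change _ ≤ φ s₀ at h2
  have h3 : (deriv φ s₀ - β) * (S - s₀) ≤ 0 := by nlinarith
  have h4 : (deriv φ s₀ - β) * s₀ ≤ 0 := by
    rcases hsgn with ⟨h0, hS0⟩ | ⟨h0, hS0⟩
    · have : deriv φ s₀ - β ≤ 0 := by nlinarith
      exact mul_nonpos_of_nonpos_of_nonneg this h0
    · have : 0 ≤ deriv φ s₀ - β := by nlinarith
      exact mul_nonpos_of_nonneg_of_nonpos this h0
  linarith

/-- A tangent `α + β * s` of the perturbed profile lifts to the minorant `α * ρ + β * ζ`, which is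
subadditive because `α ≥ 0`. Taking the tangent at the ratio belonging to `v₁ + v₂` gives equality
there. -/
lemma isSublinear_add_radialPerturbation (H : IsRotationOf k h w e f) (hk : IsSublinear k)
    (hh : IsSublinear h) {γ : ℝ → ℝ} (hγ : Continuous γ) {M : ℝ} (hM : ∀ s, M ≤ |s| → γ s = 0)
    (hconv : ConvexOn ℝ Set.univ (fun s => h (f + s • e) + γ s))
    (hd : Differentiable ℝ (fun s => h (f + s • e) + γ s)) :
    IsSublinear (fun v => k v + radialPerturbation w γ v) := by
  refine ⟨fun c hc v => by rw [hk.smul c hc, radialPerturbation_smul w γ hc]; ring, ?_⟩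
  have hform : ∀ v, perp w v ≠ 0 → k v + radialPerturbation w γ v = ‖perp w v‖ *
      (h (f + (inner ℝ w v / ‖perp w v‖ : ℝ) • e) + γ (inner ℝ w v / ‖perp w v‖)) := by
    intro v hv
    have hpos : 0 < ‖perp w v‖ := norm_pos_iff.2 hv
    rw [mul_add, ← hh.smul _ hpos, H.apply_eq, radialPerturbation, smul_add, smul_smul,
      mul_div_cancel₀ _ hpos.ne']
  have hgen : ∀ v₁ v₂, perp w v₁ ≠ 0 → perp w v₂ ≠ 0 → perp w (v₁ + v₂) ≠ 0 →
      k (v₁ + v₂) + radialPerturbation w γ (v₁ + v₂) ≤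
      (k v₁ + radialPerturbation w γ v₁) + (k v₂ + radialPerturbation w γ v₂) := by
    intro v₁ v₂ h₁ h₂ h₁₂
    obtain ⟨α, β, hα, heq, hle⟩ := H.exists_tangent hh hM hconv hd
      (inner ℝ w (v₁ + v₂) / ‖perp w (v₁ + v₂)‖)
    have hlow : ∀ v, perp w v ≠ 0 →
        α * ‖perp w v‖ + β * inner ℝ w v ≤ k v + radialPerturbation w γ v := by
      intro v hv
      have hpos : 0 < ‖perp w v‖ := norm_pos_iff.2 hv
      rw [hform v hv]
      have := mul_le_mul_of_nonneg_left (hle (inner ℝ w v / ‖perp w v‖)) hpos.le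
      refine le_trans (le_of_eq ?_) this
      field_simp
    have hpos : 0 < ‖perp w (v₁ + v₂)‖ := norm_pos_iff.2 h₁₂
    have htop : k (v₁ + v₂) + radialPerturbation w γ (v₁ + v₂) =
        α * ‖perp w (v₁ + v₂)‖ + β * inner ℝ w (v₁ + v₂) := by
      rw [hform _ h₁₂, heq]
      field_simp
    have hn : α * ‖perp w (v₁ + v₂)‖ ≤ α * (‖perp w v₁‖ + ‖perp w v₂‖) := by
      rw [perp_add]
      exact mul_le_mul_of_nonneg_left (norm_add_le _ _) hα
    rw [htop, inner_add_right]
    linarith [hlow v₁ h₁, hlow v₂ h₂]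
  obtain ⟨m, hm, hwm⟩ := exists_unit_inner_eq_zero (E := E3) (by simp) w
  intro v₁ v₂
  have hcont : Continuous fun v => k v + radialPerturbation w γ v :=
    hk.continuous.add (continuous_radialPerturbation w hγ hM)
  have hlim : ∀ (v : E3) (c : ℝ), Filter.Tendsto
      (fun t : ℝ => k (v + (c * t) • m) + radialPerturbation w γ (v + (c * t) • m))
      (nhdsWithin 0 (Set.Ioi 0)) (nhds (k v + radialPerturbation w γ v)) := by
    intro v c
    have h1 : Continuous fun t : ℝ => v + (c * t) • m := by fun_prop
    have h2 := (hcont.comp h1).tendsto 0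
    simp only [Function.comp_def, mul_zero, zero_smul, add_zero] at h2
    exact h2.mono_left nhdsWithin_le_nhds
  -- The ratio is meaningless on the axis, so the vectors are pushed off it by `t`, `t` and `2 * t`
  -- times `m`, which preserves the sum, and `t` tends to `0`.
  refine le_of_tendsto_of_tendsto (hlim (v₁ + v₂) 2) ((hlim v₁ 1).add (hlim v₂ 1)) ?_
  filter_upwards [eventually_perp_add_smul_ne_zero hm hwm v₁ one_pos,
    eventually_perp_add_smul_ne_zero hm hwm v₂ one_pos,
    eventually_perp_add_smul_ne_zero hm hwm (v₁ + v₂) two_pos] with t h₁ h₂ h₁₂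
  have hsum : v₁ + v₂ + (2 * t) • m = (v₁ + (1 * t) • m) + (v₂ + (1 * t) • m) := by module
  rw [hsum] at h₁₂ ⊢
  exact hgen _ _ h₁ h₂ h₁₂

end IsRotationOf

end Lift

/-! ### Extremality passes from the solid to the profile. -/

section Converse

local notation "E2" => EuclideanSpace ℝ (Fin 2)
local notation "E3" => EuclideanSpace ℝ (Fin 3)

variable {k : E3 → ℝ} {h : E2 → ℝ} {w : E3} {e f : E2}

namespace IsRotationOf

lemma eq_combination (H : IsRotationOf k h w e f) (u : E2) :
    u = (inner ℝ f u : ℝ) • f + (inner ℝ e u : ℝ) • e :=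
  eq_combination_of_finrank_eq_two (by simp) H.norm_e H.norm_f H.inner_e_f u

lemma neg_combination (r z : ℝ) : -(r • f + z • e) = (-r) • f + (-z) • e := by module

/-- Perturbations of the profile which are even with respect to the axis are linear as soon as the
body of revolution admits only linear perturbations. -/
lemma linear_of_even (H : IsRotationOf k h w e f)
    (hK : ∀ D : E3 → ℝ, (∀ v, D (-v) = -D v) → IsSublinear (fun v => k v + D v) →
      IsSublinear (fun v => k v - D v) → ∃ b : E3, ∀ v, D v = inner ℝ b v)
    {d : E2 → ℝ} (hodd : ∀ u, d (-u) = -d u) (hp : IsSublinear (fun u => h u + d u))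
    (hm : IsSublinear (fun u => h u - d u))
    (heven : ∀ r z : ℝ, d ((-r) • f + z • e) = d (r • f + z • e)) :
    ∃ b : E2, ∀ u, d u = inner ℝ b u := by
  obtain ⟨m, hm1, hwm⟩ := exists_unit_inner_eq_zero (E := E3) (by simp) w
  have hp' := hp.revolve (w := w) (e := e) (f := f) fun r z => by rw [H.even, heven]
  have hm' := hm.revolve (w := w) (e := e) (f := f) fun r z => by rw [H.even, heven]
  simp only [← H.apply_eq] at hp' hm'
  obtain ⟨b, hb⟩ := hK (fun v => d (‖perp w v‖ • f + (inner ℝ w v : ℝ) • e)) (fun v => by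
    rw [perp_neg, norm_neg, inner_neg_right, ← hodd, neg_combination, heven]) hp' hm'
  refine ⟨(inner ℝ b m : ℝ) • f + (inner ℝ b w : ℝ) • e, fun u => ?_⟩
  have h1 := hb ((inner ℝ f u : ℝ) • m + (inner ℝ e u : ℝ) • w)
  simp only [perp_combination H.norm_w hwm, inner_combination H.norm_w hwm, norm_smul, hm1, mul_one,
    Real.norm_eq_abs] at h1
  have h2 : d (|inner ℝ f u| • f + (inner ℝ e u : ℝ) • e) = d u := by
    conv_rhs => rw [H.eq_combination u]
    rcases abs_choice (inner ℝ f u : ℝ) with hr | hr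
    · rw [hr]
    · rw [hr, heven]
  rw [← h2, h1, inner_add_right, inner_add_left, inner_smul_right, inner_smul_right,
    real_inner_smul_left, real_inner_smul_left]
  ring

/-- Perturbations of the profile which are antisymmetric with respect to the axis are linear as soon
as the body of revolution admits only linear perturbations. -/
lemma linear_of_antisymmetric (H : IsRotationOf k h w e f) (hk : IsSublinear k) (hh : IsSublinear h)
    (hh1 : HasWidthOne h)
    (hK : ∀ D : E3 → ℝ, (∀ v, D (-v) = -D v) → IsSublinear (fun v => k v + D v) →
      IsSublinear (fun v => k v - D v) → ∃ b : E3, ∀ v, D v = inner ℝ b v)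
    {d : E2 → ℝ} (hodd : ∀ u, d (-u) = -d u) (hp : IsSublinear (fun u => h u + d u))
    (hm : IsSublinear (fun u => h u - d u))
    (hanti : ∀ r z : ℝ, d ((-r) • f + z • e) = -d (r • f + z • e)) :
    ∃ b : E2, ∀ u, d u = inner ℝ b u := by
  obtain ⟨m, hm1, hwm⟩ := exists_unit_inner_eq_zero (E := E3) (by simp) w
  have hne : ∀ s : ℝ, f + s • e ≠ 0 := by
    intro s h0
    have h1 : inner ℝ f (f + s • e) = (1 : ℝ) := by
      rw [inner_add_right, inner_smul_right, real_inner_comm e f, H.inner_e_f,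
        real_inner_self_eq_norm_sq, H.norm_f]
      norm_num
    rw [h0, inner_zero_right] at h1
    exact zero_ne_one h1
  have hline : ∀ {g : E2 → ℝ}, IsSublinear g → HasWidthOne g →
      Differentiable ℝ (fun s : ℝ => g (f + s • e)) ∧
      ConvexOn ℝ Set.univ (fun s : ℝ => g (f + s • e)) := by
    intro g hg hg1
    refine ⟨fun s => ?_, convex_univ, fun x _ y _ a b ha hb hab => ?_⟩
    · have h1 : DifferentiableAt ℝ (fun s : ℝ => f + s • e) s := by fun_prop
      exact (hg.differentiableAt hg1 (hne s)).comp s h1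
    · have h1 := hg.convexOn.2 (Set.mem_univ (f + x • e)) (Set.mem_univ (f + y • e)) ha hb hab
      refine le_trans (le_of_eq ?_) h1
      rw [smul_eq_mul, smul_eq_mul, smul_add, smul_add, add_add_add_comm, ← add_smul, hab, one_smul,
        smul_smul, smul_smul, ← add_smul]
  obtain ⟨hηd, -⟩ := hline hh hh1
  obtain ⟨hpd, hpc⟩ := hline hp (hh1.add_odd hodd)
  obtain ⟨-, hmc⟩ := hline hm (hh1.sub_odd hodd)
  have hδd : Differentiable ℝ (fun s : ℝ => d (f + s • e)) := by
    simpa only [add_sub_cancel_left] using hpd.fun_sub hηd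
  -- Oddness and antisymmetry in the axis combine to symmetry along the tangent line.
  have hδe : ∀ s : ℝ, d (f + (-s) • e) = d (f + s • e) := by
    intro s
    have h1 := hanti 1 (-s)
    have h2 := hodd ((1 : ℝ) • f + s • e)
    rw [neg_combination, h1, neg_inj] at h2
    simpa using h2
  have hconst : ∀ s : ℝ, d (f + s • e) = d f := by
    intro s
    have := even_perturbation_eq_const hηd hδd hpc hmc hδe ?_ s
    · simpa using this
    intro γ hγd hγodd ⟨M, hM⟩ hγp hγm
    have hDp := H.isSublinear_add_radialPerturbation hk hh hγd.continuous hM hγp (hηd.add hγd)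
    have hDm := H.isSublinear_add_radialPerturbation hk hh (γ := fun s => -γ s)
      hγd.continuous.neg (M := M) (fun s hs => by rw [hM s hs, neg_zero])
      (by simpa only [← sub_eq_add_neg] using hγm) (hηd.add hγd.neg)
    obtain ⟨b, hb⟩ := hK (radialPerturbation w γ) (fun v => by
      rw [radialPerturbation, perp_neg, norm_neg, inner_neg_right, neg_div, hγodd,
        radialPerturbation, mul_neg]) hDp (by
      convert hDm using 2 with v
      simp only [radialPerturbation, mul_neg, sub_eq_add_neg])
    have hγb : ∀ s, γ s = inner ℝ b m + s * inner ℝ b w := by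
      intro s
      have h1 := hb ((1 : ℝ) • m + s • w)
      rw [radialPerturbation, perp_combination H.norm_w hwm, inner_combination H.norm_w hwm,
        one_smul, hm1, one_mul, div_one, inner_add_right, inner_smul_right] at h1
      exact h1
    -- The lifted perturbation is linear, so `γ` is affine; its zeros at `|M|` and `|M| + 1` make it
    -- vanish.
    have h1 := hM |M| (by rw [abs_abs]; exact le_abs_self M)
    have h2 := hM (|M| + 1) (by
      rw [abs_of_nonneg (by positivity)]
      linarith [le_abs_self M])
    rw [hγb] at h1 h2
    have h3 : inner ℝ b w = (0 : ℝ) := by linarith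
    have h4 : inner ℝ b m = (0 : ℝ) := by rw [h3] at h1; linarith
    intro s
    rw [hγb, h3, h4, mul_zero, add_zero]
  have hpos : ∀ r z : ℝ, 0 < r → d (r • f + z • e) = r * d f := by
    intro r z hr
    have h1 := hp.smul r hr (f + (z / r) • e)
    rw [hh.smul r hr, mul_add, hconst, smul_add, smul_smul, mul_div_cancel₀ _ hr.ne'] at h1
    linarith
  refine ⟨d f • f, fun u => ?_⟩
  rw [real_inner_smul_left]
  conv_lhs => rw [H.eq_combination u]
  generalize (inner ℝ f u : ℝ) = r
  generalize (inner ℝ e u : ℝ) = z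
  rcases lt_trichotomy r 0 with hr | rfl | hr
  · have h1 := hanti (-r) z
    rw [neg_neg, hpos (-r) z (by linarith)] at h1
    rw [h1]
    ring
  · have h1 := hanti 0 z
    rw [neg_zero] at h1
    linarith
  · rw [hpos r z hr, mul_comm]

/-- If the body of revolution admits only linear perturbations, so does its profile. -/
theorem linear_of_spatial (H : IsRotationOf k h w e f) (hk : IsSublinear k) (hh : IsSublinear h)
    (hh1 : HasWidthOne h)
    (hK : ∀ D : E3 → ℝ, (∀ v, D (-v) = -D v) → IsSublinear (fun v => k v + D v) →
      IsSublinear (fun v => k v - D v) → ∃ b : E3, ∀ v, D v = inner ℝ b v)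
    {d : E2 → ℝ} (hodd : ∀ u, d (-u) = -d u) (hp : IsSublinear (fun u => h u + d u))
    (hm : IsSublinear (fun u => h u - d u)) : ∃ b : E2, ∀ u, d u = inner ℝ b u := by
  -- `σ` is the reflection in the axis. It preserves `h`, so `d ∘ σ` is a perturbation along with
  -- `d`, and so are half their sum and half their difference.
  let σ : E2 →ₗ[ℝ] E2 :=
    ((innerSL ℝ e).smulRight e - (innerSL ℝ f).smulRight f : E2 →L[ℝ] E2)
  have hσ : ∀ r z : ℝ, σ (r • f + z • e) = (-r) • f + z • e := by
    intro r z
    have hfe : inner ℝ f e = 0 := by rw [real_inner_comm, H.inner_e_f]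
    have h1 : σ (r • f + z • e) = (inner ℝ e (r • f + z • e) : ℝ) • e -
        (inner ℝ f (r • f + z • e) : ℝ) • f := rfl
    rw [h1, inner_combination H.norm_e H.inner_e_f, add_comm, inner_combination H.norm_f hfe]
    module
  have hhσ : ∀ u, h (σ u) = h u := by
    intro u
    rw [H.eq_combination u, hσ, H.even]
  have hpσ := hp.comp_linear σ
  have hmσ := hm.comp_linear σ
  simp only [hhσ] at hpσ hmσ
  obtain ⟨b₁, hb₁⟩ := H.linear_of_even hK (d := fun u => (1 / 2) * d u + (1 / 2) * d (σ u))
    (fun u => by rw [map_neg, hodd, hodd]; ring)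
    (by
      convert hp.linear_combination hpσ (a := 1 / 2) (b := 1 / 2) (by norm_num) (by norm_num)
        using 2 with u
      ring)
    (by
      convert hm.linear_combination hmσ (a := 1 / 2) (b := 1 / 2) (by norm_num) (by norm_num)
        using 2 with u
      ring)
    (fun r z => by rw [hσ, hσ, neg_neg]; ring)
  obtain ⟨b₂, hb₂⟩ := H.linear_of_antisymmetric hk hh hh1 hK
    (d := fun u => (1 / 2) * d u - (1 / 2) * d (σ u))
    (fun u => by rw [map_neg, hodd, hodd]; ring)
    (by
      convert hp.linear_combination hmσ (a := 1 / 2) (b := 1 / 2) (by norm_num) (by norm_num)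
        using 2 with u
      ring)
    (by
      convert hm.linear_combination hpσ (a := 1 / 2) (b := 1 / 2) (by norm_num) (by norm_num)
        using 2 with u
      ring)
    (fun r z => by rw [hσ, hσ, neg_neg]; ring)
  refine ⟨b₁ + b₂, fun u => ?_⟩
  rw [inner_add_left, ← hb₁, ← hb₂]
  ring

end IsRotationOf

end Converse

/-! ### Moving the axis to the origin, and the conclusion. -/

section Translation

variable {E : Type*} [NormedAddCommGroup E] [InnerProductSpace ℝ E]

lemma IsSublinear.sub_inner {h : E → ℝ} (hh : IsSublinear h) (a : E) :
    IsSublinear (fun v => h v - inner ℝ a v) := by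
  simp only [sub_eq_add_neg, ← inner_neg_left]
  exact hh.add_linear (innerSL ℝ (-a) : E →L[ℝ] ℝ).toLinearMap

lemma HasWidthOne.sub_inner {h : E → ℝ} (hh : HasWidthOne h) (a : E) :
    HasWidthOne (fun v => h v - inner ℝ a v) :=
  hh.sub_odd fun u => inner_neg_right a u

lemma isSublinear_sub_inner_add_iff {h d : E → ℝ} (a : E) :
    IsSublinear (fun v => (h v - inner ℝ a v) + d v) ↔ IsSublinear (fun v => h v + d v) := by
  constructor
  · intro hh
    convert hh.sub_inner (-a) using 2 with v
    rw [inner_neg_left]; ring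
  · intro hh
    convert hh.sub_inner a using 2 with v
    ring

lemma isSublinear_sub_inner_sub_iff {h d : E → ℝ} (a : E) :
    IsSublinear (fun v => (h v - inner ℝ a v) - d v) ↔ IsSublinear (fun v => h v - d v) := by
  simpa only [← sub_eq_add_neg] using isSublinear_sub_inner_add_iff (h := h) (d := fun v => -d v) a

end Translation

theorem theoremC (K : ConvexBody (EuclideanSpace ℝ (Fin 3)))
    (hK : HasConstantWidth K) (hsym : IsAxiallySymmetric K) :
    (∃ C : ConvexBody (EuclideanSpace ℝ (Fin 2)), Generates C K) ∧
      ∀ C : ConvexBody (EuclideanSpace ℝ (Fin 2)), Generates C K →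
        (IsExtremeConstantWidth K ↔ IsExtremeConstantWidth C) := by
  refine ⟨exists_generates hK hsym, fun C hCK => ?_⟩
  have hC := hCK.1
  obtain ⟨p, e, f, a, w, H⟩ := hCK.exists_isRotationOf
  have hkw := ((hasConstantWidth_iff K).1 hK).sub_inner a
  have hhw := ((hasConstantWidth_iff C).1 hC).sub_inner p
  rw [isExtremeConstantWidth_iff, isExtremeConstantWidth_iff]
  constructor
  · rintro ⟨-, hext⟩
    refine ⟨hC, fun d hd h1 h2 => ?_⟩
    refine H.linear_of_spatial ((isSublinear_supportFunction K).sub_inner a)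
      ((isSublinear_supportFunction C).sub_inner p) hhw (fun D hD hD1 hD2 => ?_) hd
      ((isSublinear_sub_inner_add_iff p).2 h1) ((isSublinear_sub_inner_sub_iff p).2 h2)
    exact hext D hD ((isSublinear_sub_inner_add_iff a).1 hD1)
      ((isSublinear_sub_inner_sub_iff a).1 hD2)
  · rintro ⟨-, hext⟩
    refine ⟨hK, fun D hD h1 h2 => ?_⟩
    refine H.linear_of_planar hkw (fun d hd hd1 hd2 => ?_) hD
      ((isSublinear_sub_inner_add_iff a).2 h1) ((isSublinear_sub_inner_sub_iff a).2 h2)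
    exact hext d hd ((isSublinear_sub_inner_add_iff p).1 hd1)
      ((isSublinear_sub_inner_sub_iff p).1 hd2)
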